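/- **Setting.** Let $k\ge 2$, $M\ge1$, $T\ge1$ be integers, and let $\mathcal X$ be a set with a $k$-ary hierarchical partition: cells $\mathcal P_{h,i}$ ($h\ge 0$, $1\le i\le k^h$) with $\mathcal P_{0,1}=\mathcal X$, $\mathcal P_{h,i}=\bigcup_{j=0}^{k-1}\mathcal P_{h+1,ki-j}$, cells of equal depth disjoint, and a representative point $x_{h,i}\in\mathcal P_{h,i}$ of each cell. Client $m\in\{1,\dots,M\}$ has a local objective $f_m:\mathcal X\to[0,1]$. The global objective is $f=\frac1M\sum_m f_m$, and $f^*=\sup f$. *Local smoothness:* there are $\nu_1>0$, $\rho\in(0,1)$ and $\ell:\mathcal X^2\to[0,\infty)$ with $\ell(x,x)=0$ such that $\sup_{x,y\in\mathcal P_{h,i}}\ell(x,y)\le\nu_1\rho^h$ for all $h,i$, and $f^*-f(y)\le f^*-f(x)+\max\{f^*-f(x),\ell(x,y)\}$ for all $x,y\in\mathcal X$. *Near-optimality dimension* $d\ge0$ with constant $C$: for every $h\ge0$, $\#\{i\in\{1,\dots,k^h\}: f^*-f(x_{h,i})\le 6\nu_1\rho^h\}\le C(\rho^{h})^{-d}$.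 *Rewards and noise:* let $\epsilon>0$, $\delta=1/M$, $\sigma^2=2\log(1.25/\delta)/\epsilon^2$. When client $m$ pulls node $(h,i)$ for the $s$-th time, it receives a reward $r_{m,h,i,s}\in[0,1]$ of mean $f_m(x_{h,i})$, and adds a noise $z_{m,h,i,s}\sim\mathcal N(0,\sigma^2)$ to it; all rewards and noises are independent. **Algorithm (DP-Fed-PNE).** Put $c=\sqrt{4+16\sigma^2}$, $c_1=(2M)^{1/8}$, $\tau_h=\big\lceil \frac{c^2\log(c_1T/\delta)}{\nu_1^2}\rho^{-2h}\big\rceil$, $t_h=\lceil\tau_h/M\rceil$, $b_h=c\sqrt{\log(c_1T/\delta)/(Mt_h)}$. Start with the root as the only surviving node. In each phase: (1) let $\mathcal K$ be the set of children of the surviving nodes, and $h$ their depth; (2) while $|\mathcal K|\tau_h\le M$ or $\tau_h\le1$, replace $\mathcal K$ by the set of children of its nodes, and $h$ by $h+1$; (3) every client goes through the nodes of $\mathcal K$ one after the other, in an arbitrary order, and pulls each of them in $t_h$ rounds; (4) with $\widehat\mu_{h,i}$ the average over all clients and pulls of the noisy rewards of $(h,i)$, eliminate the nodes $(h,i)\in\mathcal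 K$ with $\widehat\mu_{h,i}+b_h+\nu_1\rho^h<\max_{(h,j)\in\mathcal K}\widehat\mu_{h,j}-b_h$; the others survive. Stop after $T$ rounds. If $x_{m,t}$ is the representative point of the node that client $m$ pulls in round $t$, the cumulative regret is $R(T)=\sum_{m=1}^M\sum_{t=1}^T\big(f^*-f(x_{m,t})\big)$. **Theorem.** Under these assumptions $R(T)$ is integrable and $$\mathbb E[R(T)]\le C_3(\epsilon,\delta)\,M^{1-\frac1{2\log_k\rho}}+C_4(\epsilon,\delta)\,M^{\frac{d+1}{d+2}}\,T^{\frac{d+1}{d+2}}\,(\log (MT))^{\frac1{d+2}},$$ where $$C_3(\epsilon,\delta)=\frac{48k\nu_1}{\rho^2-\rho^3}\left(\frac{\nu_1^2\epsilon^2}{4\epsilon^2+32\log(1.25/\delta)}\right)^{-\frac1{2\log_k\rho}}+1,$$ $$C_4(\epsilon,\delta)=2\left(\frac{24kC\,(4\epsilon^2+32\log(1.25/\delta))\,\rho^{-(d+4)}(12\nu_1)^{d+1}}{\nu_1\epsilon^2(\rho^{-(d+1)}-1)}\right)^{\frac1{d+2}}\left(1+\tfrac18\log(2M)\right).$$ 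-/

import Mathlib

open MeasureTheory ProbabilityTheory

noncomputable section

namespace FedBandit

/-- The pair `(h, i)` indexes a node of the `k`-ary tree: depth `h`, index `i ∈ {1, …, k ^ h}`. -/
def IsNode (k h i : ℕ) : Prop := 1 ≤ i ∧ i ≤ k ^ h

/-- A `k`-ary hierarchical partition of `X`: the root cell is `X`, every cell is the union of its
`k` children `(h + 1, k i - j)`, `0 ≤ j ≤ k - 1`, cells of equal depth are disjoint, and every cell
has a representative point, the point that is evaluated when the node is pulled. -/
structure HierarchicalPartition (X : Type*) (k : ℕ) where
  cell : ℕ → ℕ → Set X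
  point : ℕ → ℕ → X
  cell_root : cell 0 1 = Set.univ
  cell_split : ∀ h i, IsNode k h i → cell h i = ⋃ j ∈ Finset.range k, cell (h + 1) (k * i - j)
  cell_disjoint : ∀ h i i', IsNode k h i → IsNode k h i' → i ≠ i' → Disjoint (cell h i) (cell h i')
  point_mem : ∀ h i, IsNode k h i → point h i ∈ cell h i

/-- The global objective: the average of the local objectives. -/
def globalObj {X : Type*} {M : ℕ} (floc : Fin M → X → ℝ) (x : X) : ℝ :=
  (∑ m, floc m x) / M

/-- The local smoothness assumption on the global objective `f` with respect to the partition `P`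
and the dissimilarity `l`: the diameter of a cell of depth `h` is at most `ν₁ ρ ^ h`, and `f` is
weakly Lipschitz. -/
structure LocallySmooth {X : Type*} {k : ℕ} (P : HierarchicalPartition X k) (f : X → ℝ)
    (l : X → X → ℝ) (ν₁ ρ : ℝ) : Prop where
  dissim_nonneg : ∀ x y, 0 ≤ l x y
  dissim_self : ∀ x, l x x = 0
  diam_le : ∀ h i, IsNode k h i → ∀ x ∈ P.cell h i, ∀ y ∈ P.cell h i, l x y ≤ ν₁ * ρ ^ h
  weak_lipschitz : ∀ x y,
    (⨆ z, f z) - f y ≤ ((⨆ z, f z) - f x) + max ((⨆ z, f z) - f x) (l x y)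

open Classical in
/-- `d` is a near-optimality dimension of `f`, with constant `C`: at each depth `h`, at most
`C (ρ ^ h) ^ (-d)` nodes are `6 ν₁ ρ ^ h`-optimal. A node counts as optimal here only if its
representative point is, so that this asks no more than the same bound on the number of cells `A`
with `sup_A f ≥ f* - 6 ν₁ ρ ^ h`. -/
def NearOptimalityDim {X : Type*} {k : ℕ} (P : HierarchicalPartition X k) (f : X → ℝ)
    (ν₁ ρ C d : ℝ) : Prop :=
  ∀ h : ℕ,
    ((((Finset.Icc 1 (k ^ h)).filter
      fun i => (⨆ z, f z) - f (P.point h i) ≤ 6 * ν₁ * ρ ^ h).card : ℕ) : ℝ) ≤ C * (ρ ^ h) ^ (-d)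

/-- The random environment. `r m h i s` is the reward of client `m` in its `s`-th pull of the node
`(h, i)` and `z m h i s` is the Gaussian noise of variance `v` that is added to it; all of these
are mutually independent, the rewards are in `[0, 1]` and have mean `f_m (x_{h,i})`. -/
structure Environment {X Ω : Type*} [MeasurableSpace Ω] {k M : ℕ} (P : HierarchicalPartition X k)
    (floc : Fin M → X → ℝ) (v : ℝ) (μ : Measure Ω) (r z : Fin M → ℕ → ℕ → ℕ → Ω → ℝ) : Prop where
  reward_measurable : ∀ m h i s, IsNode k h i → Measurable (r m h i s)
  reward_mem : ∀ m h i s, IsNode k h i → ∀ᵐ ω ∂μ, r m h i s ω ∈ Set.Icc (0 : ℝ) 1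
  reward_mean : ∀ m h i s, IsNode k h i → ∫ ω, r m h i s ω ∂μ = floc m (P.point h i)
  noise_measurable : ∀ m h i s, IsNode k h i → Measurable (z m h i s)
  noise_law : ∀ m h i s, IsNode k h i → μ.map (z m h i s) = gaussianReal 0 v.toNNReal
  indep : iIndepFun
    (fun (a : Bool × Fin M × {n : ℕ × ℕ // IsNode k n.1 n.2} × ℕ) =>
      if a.1 then r a.2.1 a.2.2.1.1.1 a.2.2.1.1.2 a.2.2.2
      else z a.2.1 a.2.2.1.1.1 a.2.2.1.1.2 a.2.2.2) μ

/-- The inputs of the algorithm: arity `k`, number of clients `M`, horizon `T`, smoothness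
parameters `ν₁, ρ`, confidence `δ`, and the constants `c, c₁` of the confidence bound. -/
structure Params where
  k : ℕ
  M : ℕ
  T : ℕ
  ν₁ : ℝ
  ρ : ℝ
  δ : ℝ
  c : ℝ
  c₁ : ℝ

namespace Params

variable (A : Params)

/-- The threshold `τ_h = ⌈c² log(c₁ T / δ) ρ^{-2h} / ν₁²⌉`. -/
def tau (h : ℕ) : ℕ :=
  ⌈A.c ^ 2 * Real.log (A.c₁ * A.T / A.δ) / A.ν₁ ^ 2 * (A.ρ ^ (2 * h))⁻¹⌉₊

/-- The number `t_{m,h,i} = ⌈τ_h / M⌉` of pulls of a node of depth `h` by each client. -/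
def pulls (h : ℕ) : ℕ := ⌈(A.tau h : ℝ) / A.M⌉₊

/-- The confidence width `c √(log(c₁ T / δ) / T_{h,i})`, where `T_{h,i} = M t_{m,h,i}`. -/
def width (h : ℕ) : ℝ :=
  A.c * Real.sqrt (Real.log (A.c₁ * A.T / A.δ) / ((A.M * A.pulls h : ℕ) : ℝ))

/-- The indices of the children of the nodes (of one depth) with indices in `K`. -/
def children (K : Finset ℕ) : Finset ℕ :=
  K.biUnion fun i => (Finset.range A.k).image fun j => A.k * i - j

/-- The condition of the inner `while` loop, for the current set `K` of nodes of depth `h`. -/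
def KeepExpanding (h : ℕ) (K : Finset ℕ) : Prop :=
  K.card * A.tau h ≤ A.M ∨ A.tau h ≤ 1

/-- The number of passes of the inner `while` loop when it is entered with the set `K` of nodes of
depth `h`: the first `n` such that the condition fails after `n` passes. -/
def passes (h : ℕ) (K : Finset ℕ) : ℕ :=
  sInf {n | ¬ A.KeepExpanding (h + n) (A.children^[n] K)}

/-- From the nodes that survived the previous phase (depth and set of indices) to the nodes
`𝒦^p` that are sampled in the next phase. -/
def expand (S : ℕ × Finset ℕ) : ℕ × Finset ℕ :=
  let K := A.children S.2
  let n := A.passes (S.1 + 1) K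
  (S.1 + 1 + n, A.children^[n] K)

/-- The global mean estimate of the node `(h, i)` from the noisy rewards `y`. -/
def estimate (y : Fin A.M → ℕ → ℕ → ℕ → ℝ) (h i : ℕ) : ℝ :=
  (∑ m, (∑ s ∈ Finset.range (A.pulls h), y m h i s) / A.pulls h) / A.M

open Classical in
/-- The nodes of `𝒦^p` that are not eliminated at the end of the phase: the node `i` is eliminated
when its upper bound is below the lower bound of a node `j` with the largest estimate. All nodes
of the phase have the same depth and width, so that ties for the largest estimate do not matter. -/
def eliminate (y : Fin A.M → ℕ → ℕ → ℕ → ℝ) (S : ℕ × Finset ℕ) : ℕ × Finset ℕ :=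
  (S.1, S.2.filter fun i =>
    ¬ ∃ j ∈ S.2, (∀ i' ∈ S.2, A.estimate y S.1 i' ≤ A.estimate y S.1 j) ∧
      A.estimate y S.1 i + A.width S.1 + A.ν₁ * A.ρ ^ S.1 < A.estimate y S.1 j - A.width S.1)

/-- The nodes that survive the first `p` phases; before the first phase this is the root. -/
def survivors (y : Fin A.M → ℕ → ℕ → ℕ → ℝ) : ℕ → ℕ × Finset ℕ
  | 0 => (0, {1})
  | p + 1 => A.eliminate y (A.expand (survivors y p))

/-- The nodes that client `m` pulls in phase `p + 1`, one entry per round; `order` lists the nodes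
of a phase in the order in which the clients go through them. -/
def phasePulls (order : Fin A.M → ℕ → Finset ℕ → List ℕ) (y : Fin A.M → ℕ → ℕ → ℕ → ℝ)
    (m : Fin A.M) (p : ℕ) : List (ℕ × ℕ) :=
  let S := A.expand (A.survivors y p)
  (order m S.1 S.2).flatMap fun i => List.replicate (A.pulls S.1) (S.1, i)

/-- The node that client `m` pulls in round `t + 1`, for `t < T`. Every phase takes at least one
round, so that the first `T` phases cover the horizon; the last one may be cut off by it. -/
def nodeAt (order : Fin A.M → ℕ → Finset ℕ → List ℕ) (y : Fin A.M → ℕ → ℕ → ℕ → ℝ)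
    (m : Fin A.M) (t : ℕ) : ℕ × ℕ :=
  ((List.range A.T).flatMap (A.phasePulls order y m)).getD t (0, 1)

/-- The cumulative regret `∑_m ∑_{t ≤ T} (f* - f(x_{m,t}))` of the algorithm on the noisy
rewards `y`. -/
def regret {X : Type*} {k : ℕ} (P : HierarchicalPartition X k) (f : X → ℝ)
    (order : Fin A.M → ℕ → Finset ℕ → List ℕ) (y : Fin A.M → ℕ → ℕ → ℕ → ℝ) : ℝ :=
  ∑ m, ∑ t ∈ Finset.range A.T,
    ((⨆ x, f x) - f (P.point (A.nodeAt order y m t).1 (A.nodeAt order y m t).2))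

end Params

/-- The noise variance `σ² = 2 log(1.25 / δ) / ε²`. -/
def noiseVar (ε δ : ℝ) : ℝ := 2 * Real.log (1.25 / δ) / ε ^ 2

/-- The inputs of the differentially private algorithm: `δ = 1 / M`, `c = √(4 + 16 σ²)` and
`c₁ = (2 M)^{1/8}`. -/
def dpParams (k M T : ℕ) (ν₁ ρ ε : ℝ) : Params where
  k := k
  M := M
  T := T
  ν₁ := ν₁
  ρ := ρ
  δ := 1 / (M : ℝ)
  c := Real.sqrt (4 + 16 * noiseVar ε (1 / (M : ℝ)))
  c₁ := (2 * (M : ℝ)) ^ ((1 : ℝ) / 8)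

/-- The first constant of the regret bound. -/
def C₃ (k : ℕ) (ν₁ ρ ε δ : ℝ) : ℝ :=
  48 * k * ν₁ / (ρ ^ 2 - ρ ^ 3) *
    (ν₁ ^ 2 * ε ^ 2 / (4 * ε ^ 2 + 32 * Real.log (1.25 / δ))) ^ (-(1 / (2 * Real.logb k ρ))) + 1

/-- The second constant of the regret bound. -/
def C₄ (k M : ℕ) (ν₁ ρ C d ε δ : ℝ) : ℝ :=
  2 * (24 * k * C * (4 * ε ^ 2 + 32 * Real.log (1.25 / δ)) * ρ ^ (-(d + 4)) * (12 * ν₁) ^ (d + 1) /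
      (ν₁ * ε ^ 2 * (ρ ^ (-(d + 1)) - 1))) ^ (1 / (d + 2)) *
    (1 + 1 / 8 * Real.log (2 * M))

end FedBandit

end

/-! Consider the event that, in every phase completed within the horizon, each estimate is within
`width` of the value of `f`. The choice of `tau` makes the width at depth `h` at most `ν₁ ρ ^ h`. On
this event a node in whose cell `f` has supremum `f*` is always left, and survivors of depth `h`
have gap at most `6 ν₁ ρ ^ h` (`survivors_gap`). Weak Lipschitz continuity at most doubles this
bound inside their cells, hence for the nodes sampled next (`sampled_gap`).

The regret is then charged phase by phase, a phase of depth `j + 1` to the index `j`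
(`cost_le_phaseCost`). While `τ_j ≤ M`, the crude bounds `k ^ (j + 1)` on the number of nodes and
`12 ν₁` on the gap suffice: these costs form a geometric sum in `k`, which gives the first term.
Once `τ_j > M`, the inner loop makes no pass, so the sampled nodes are children of survivors of
depth `j`. The near-optimality dimension counts these, and the cost is of order `ρ ^ (-j (d + 1))`.
Such phases with `j ≥ n` are charged `12 ν₁ ρ ^ n` per pull instead, and `n` is chosen by balancing
(`exists_pow_balance`).

The sampled nodes are random. Since every phase goes strictly deeper, the choice of a set of nodes
depends on samples at smaller depths only, and is independent of the estimates made for it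
(`measure_sampled_inter_deviation`). The union bound therefore costs the expected number of nodes
sampled in completed phases, which is at most `T` because each takes a round
(`measure_not_wellEstimated_le`). A sub-Gaussian tail bounds the failure probability of one estimate
by `M⁻¹ (M T)⁻⁸`, so the bad event adds at most 1 to the expected regret: this is the `+ 1` in `C₃`.
The factor `1 + log (2 M) / 8` in `C₄` absorbs the constant `c₁` when `log (M T) ≥ 1`; the cases `M
T ≤ 2` follow from trivial bounds. -/

namespace FedBandit

/-! ### Optimal cells and gaps in the partition tree. -/

/-- A node of depth `h` whose cell contains points with values arbitrarily close to the supremum. -/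
def IsOptimalNode {X : Type*} {k : ℕ} (P : HierarchicalPartition X k) (f : X → ℝ) (h i : ℕ) : Prop :=
  IsNode k h i ∧ ∀ η > 0, ∃ x ∈ P.cell h i, (⨆ z, f z) - η < f x

lemma IsNode.child {k h i j : ℕ} (hi : IsNode k h i) (hj : j < k) : IsNode k (h + 1) (k * i - j) := by
  obtain ⟨h1, h2⟩ := hi
  have h3 : k * 1 ≤ k * i := Nat.mul_le_mul_left k h1
  have h4 : k * i ≤ k * k ^ h := Nat.mul_le_mul_left k h2
  refine ⟨by omega, ?_⟩
  rw [pow_succ']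
  omega

lemma isNode_root (k : ℕ) : IsNode k 0 1 := ⟨le_rfl, by simp⟩

section Tree

variable {X : Type*} {k : ℕ} {P : HierarchicalPartition X k} {f : X → ℝ} {l : X → X → ℝ} {ν₁ ρ : ℝ}

lemma HierarchicalPartition.cell_child_subset (P : HierarchicalPartition X k) {h i j : ℕ}
    (hi : IsNode k h i) (hj : j < k) : P.cell (h + 1) (k * i - j) ⊆ P.cell h i := by
  rw [P.cell_split h i hi]
  exact Set.subset_biUnion_of_mem (u := fun j => P.cell (h + 1) (k * i - j)) (Finset.mem_range.2 hj)

/-- If every child stayed below the supremum by a margin, the smallest of these finitely many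
margins would work for the parent. -/
lemma IsOptimalNode.exists_child (hk : 0 < k) {h i : ℕ} (hi : IsOptimalNode P f h i) :
    ∃ j < k, IsOptimalNode P f (h + 1) (k * i - j) := by
  by_contra hcon
  have key : ∀ j : ℕ, ∃ η > 0, j < k → ∀ x ∈ P.cell (h + 1) (k * i - j), f x ≤ (⨆ z, f z) - η := by
    intro j
    by_cases hj : j < k
    · have : ¬ ∀ η > 0, ∃ x ∈ P.cell (h + 1) (k * i - j), (⨆ z, f z) - η < f x :=
        fun h' => hcon ⟨j, hj, hi.1.child hj, h'⟩
      push Not at this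
      obtain ⟨η, h1, h2⟩ := this
      exact ⟨η, h1, fun _ => h2⟩
    · exact ⟨1, one_pos, fun h' => absurd h' hj⟩
  choose η hη hbd using key
  obtain ⟨j₀, hj₀, hmin⟩ := Finset.exists_min_image (Finset.range k) η ⟨0, Finset.mem_range.2 hk⟩
  obtain ⟨x, hx, hfx⟩ := hi.2 (η j₀) (hη j₀)
  rw [P.cell_split h i hi.1] at hx
  simp only [Set.mem_iUnion, Finset.mem_range] at hx
  obtain ⟨j, hj, hxj⟩ := hx
  have h1 := hbd j hj x hxj
  have h2 := hmin j (Finset.mem_range.2 hj)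
  linarith

lemma isOptimalNode_root : IsOptimalNode P f 0 1 := by
  refine ⟨isNode_root k, fun η hη => ?_⟩
  have : Nonempty X := ⟨P.point 0 1⟩
  obtain ⟨x, hx⟩ := exists_lt_of_lt_ciSup (show (⨆ z, f z) - η < ⨆ z, f z by linarith)
  exact ⟨x, by rw [P.cell_root]; trivial, hx⟩

/-- The gap of any point in an optimal cell is at most the diameter of the cell. -/
lemma LocallySmooth.gap_le_of_isOptimalNode (hs : LocallySmooth P f l ν₁ ρ) (hν : 0 < ν₁)
    (hρ : 0 < ρ) {h i : ℕ} (hi : IsOptimalNode P f h i) {y : X}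
    (hy : y ∈ P.cell h i) : (⨆ z, f z) - f y ≤ ν₁ * ρ ^ h := by
  have hpos : 0 < ν₁ * ρ ^ h := by positivity
  refine le_of_forall_pos_le_add fun η hη => ?_
  -- The supremum need not be attained. The bound `η` serves the first summand of the weak Lipschitz
  -- inequality, the bound `ν₁ ρ ^ h` keeps the maximum at the diameter.
  obtain ⟨x, hx, hfx⟩ := hi.2 (min η (ν₁ * ρ ^ h)) (lt_min hη hpos)
  have h1 := hs.weak_lipschitz x y
  have h2 := hs.diam_le h i hi.1 x hx y hy
  have h3 : max ((⨆ z, f z) - f x) (l x y) ≤ ν₁ * ρ ^ h := by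
    refine max_le ?_ h2
    have := min_le_right η (ν₁ * ρ ^ h)
    linarith
  have := min_le_left η (ν₁ * ρ ^ h)
  linarith

/-- In the cell of a node with a representative of gap at most `6 ν₁ ρ ^ h`, all gaps are at most
`12 ν₁ ρ ^ h`. -/
lemma LocallySmooth.gap_le_of_point (hs : LocallySmooth P f l ν₁ ρ) (hν : 0 < ν₁)
    (hρ : 0 < ρ) {h i : ℕ} (hi : IsNode k h i)
    (hgap : (⨆ z, f z) - f (P.point h i) ≤ 6 * ν₁ * ρ ^ h) {y : X}
    (hy : y ∈ P.cell h i) : (⨆ z, f z) - f y ≤ 12 * ν₁ * ρ ^ h := by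
  have hpos : 0 < ν₁ * ρ ^ h := by positivity
  have h1 := hs.weak_lipschitz (P.point h i) y
  have h2 := hs.diam_le h i hi _ (P.point_mem h i hi) y hy
  have h3 : max ((⨆ z, f z) - f (P.point h i)) (l (P.point h i) y) ≤ 6 * ν₁ * ρ ^ h :=
    max_le hgap (by linarith)
  linarith

end Tree

/-! ### Thresholds, confidence widths and expansion of node sets. -/

namespace Params

/-- The standing assumptions on the inputs of the algorithm. -/
structure Admissible (A : Params) : Prop where
  two_le_k : 2 ≤ A.k
  one_le_M : 1 ≤ A.M
  ν₁_pos : 0 < A.ν₁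
  ρ_pos : 0 < A.ρ
  ρ_lt_one : A.ρ < 1
  c_pos : 0 < A.c
  log_pos : 0 < Real.log (A.c₁ * A.T / A.δ)

/-- The real number of which `τ_h` is the ceiling. -/
noncomputable def scale (A : Params) (h : ℕ) : ℝ :=
  A.c ^ 2 * Real.log (A.c₁ * A.T / A.δ) / A.ν₁ ^ 2 * (A.ρ ^ (2 * h))⁻¹

variable {A : Params}

lemma Admissible.scale_pos (hA : A.Admissible) (h : ℕ) : 0 < A.scale h := by
  have := hA.c_pos; have := hA.ν₁_pos; have := hA.ρ_pos; have := hA.log_pos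
  unfold scale
  positivity

lemma Admissible.scale_succ (hA : A.Admissible) (h : ℕ) :
    A.scale (h + 1) = A.scale h * (A.ρ ^ 2)⁻¹ := by
  have := hA.ρ_pos; have := hA.ν₁_pos
  unfold scale
  rw [mul_add, pow_add, mul_inv]
  ring

lemma Admissible.one_le_inv_sq (hA : A.Admissible) : 1 ≤ (A.ρ ^ 2)⁻¹ := by
  have := hA.ρ_pos
  exact (one_le_inv₀ (by positivity)).2 (pow_le_one₀ hA.ρ_pos.le hA.ρ_lt_one.le)

lemma Admissible.scale_mono (hA : A.Admissible) : Monotone A.scale := by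
  refine monotone_nat_of_le_succ fun h => ?_
  rw [hA.scale_succ]
  exact le_mul_of_one_le_right (hA.scale_pos h).le hA.one_le_inv_sq

lemma Admissible.tau_pos (hA : A.Admissible) (h : ℕ) : 0 < A.tau h :=
  Nat.ceil_pos.2 (hA.scale_pos h)

lemma Admissible.pulls_pos (hA : A.Admissible) (h : ℕ) : 0 < A.pulls h := by
  refine Nat.ceil_pos.2 (div_pos ?_ ?_)
  · exact_mod_cast hA.tau_pos h
  · exact_mod_cast hA.one_le_M

/-- The confidence width at depth `h` is at most the cell diameter. -/
lemma Admissible.width_le (hA : A.Admissible) (h : ℕ) : A.width h ≤ A.ν₁ * A.ρ ^ h := by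
  have hc := hA.c_pos; have hν := hA.ν₁_pos; have hρ := hA.ρ_pos; have hL := hA.log_pos
  have hM : (0 : ℝ) < A.M := by exact_mod_cast hA.one_le_M
  have hsc := hA.scale_pos h
  have h1 : A.scale h ≤ ((A.M * A.pulls h : ℕ) : ℝ) := by
    have h2 : A.scale h ≤ A.tau h := Nat.le_ceil _
    have h3 : (A.tau h : ℝ) / A.M ≤ A.pulls h := Nat.le_ceil _
    rw [div_le_iff₀ hM] at h3
    push_cast
    linarith
  have h2 : Real.log (A.c₁ * A.T / A.δ) / ((A.M * A.pulls h : ℕ) : ℝ)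
      ≤ (A.ν₁ * A.ρ ^ h / A.c) ^ 2 := by
    calc _ ≤ Real.log (A.c₁ * A.T / A.δ) / A.scale h :=
          div_le_div_of_nonneg_left hL.le hsc h1
      _ = _ := by
          unfold scale
          rw [pow_mul', sq (A.ρ ^ h)]
          field_simp
  unfold width
  calc _ ≤ A.c * (A.ν₁ * A.ρ ^ h / A.c) := by
        gcongr
        exact Real.sqrt_le_iff.2 ⟨by positivity, h2⟩
    _ = _ := by field_simp

lemma Admissible.width_nonneg (hA : A.Admissible) (h : ℕ) : 0 ≤ A.width h :=
  mul_nonneg hA.c_pos.le (Real.sqrt_nonneg _)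

lemma mem_children {K : Finset ℕ} {i : ℕ} :
    i ∈ A.children K ↔ ∃ i' ∈ K, ∃ j < A.k, A.k * i' - j = i := by
  simp [children]

lemma card_children_le (K : Finset ℕ) : (A.children K).card ≤ A.k * K.card := by
  unfold children
  rw [mul_comm]
  refine Finset.card_biUnion_le_card_mul _ _ _ fun i _ => ?_
  exact Finset.card_image_le.trans (by simp)

lemma children_nonempty (hk : 0 < A.k) {K : Finset ℕ} (hK : K.Nonempty) :
    (A.children K).Nonempty := by
  obtain ⟨i, hi⟩ := hK
  exact ⟨A.k * i - 0, mem_children.2 ⟨i, hi, 0, hk, rfl⟩⟩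

lemma iterate_children_nonempty (hk : 0 < A.k) {K : Finset ℕ} (hK : K.Nonempty) (n : ℕ) :
    (A.children^[n] K).Nonempty := by
  induction n with
  | zero => exact hK
  | succ n ih =>
    rw [Function.iterate_succ_apply']
    exact children_nonempty hk ih

lemma isNode_iterate_children {h : ℕ} {K : Finset ℕ} (hK : ∀ i ∈ K, IsNode A.k h i) (n : ℕ) :
    ∀ i ∈ A.children^[n] K, IsNode A.k (h + n) i := by
  induction n with
  | zero => exact hK
  | succ n ih =>
    intro i hi
    rw [Function.iterate_succ_apply', mem_children] at hi
    obtain ⟨i', hi', j, hj, rfl⟩ := hi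
    exact (ih i' hi').child hj

lemma exists_ancestor {X : Type*} (P : HierarchicalPartition X A.k) {h : ℕ} {K : Finset ℕ}
    (hK : ∀ i ∈ K, IsNode A.k h i) (n : ℕ) :
    ∀ i ∈ A.children^[n] K, ∃ i' ∈ K, P.cell (h + n) i ⊆ P.cell h i' := by
  induction n with
  | zero => exact fun i hi => ⟨i, hi, subset_rfl⟩
  | succ n ih =>
    intro i hi
    rw [Function.iterate_succ_apply', mem_children] at hi
    obtain ⟨i', hi', j, hj, rfl⟩ := hi
    obtain ⟨a, ha, hsub⟩ := ih i' hi'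
    exact ⟨a, ha, (P.cell_child_subset (isNode_iterate_children hK n i' hi') hj).trans hsub⟩

lemma exists_optimal_iterate_children {X : Type*} {P : HierarchicalPartition X A.k} {f : X → ℝ}
    (hk : 0 < A.k) {h : ℕ} {K : Finset ℕ} (hK : ∃ i ∈ K, IsOptimalNode P f h i) (n : ℕ) :
    ∃ i ∈ A.children^[n] K, IsOptimalNode P f (h + n) i := by
  induction n with
  | zero => exact hK
  | succ n ih =>
    obtain ⟨i, hi, hopt⟩ := ih
    obtain ⟨j, hj, hopt'⟩ := hopt.exists_child hk
    refine ⟨_, ?_, hopt'⟩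
    rw [Function.iterate_succ_apply', mem_children]
    exact ⟨i, hi, j, hj, rfl⟩

lemma expand_fst (S : ℕ × Finset ℕ) :
    (A.expand S).1 = S.1 + (A.passes (S.1 + 1) (A.children S.2) + 1) := by
  simp only [expand]; ring

lemma expand_snd (S : ℕ × Finset ℕ) :
    (A.expand S).2 = A.children^[A.passes (S.1 + 1) (A.children S.2) + 1] S.2 := by
  simp only [expand, Function.iterate_succ_apply]

/-- Every phase goes strictly deeper. The independence of the choice of nodes from their own samples
and the charging of phases to distinct depths both rest on this. -/
lemma lt_expand_fst (S : ℕ × Finset ℕ) : S.1 < (A.expand S).1 := by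
  rw [expand_fst]; omega

/-- If `τ > M` already holds one level above the sampled nodes, they are the children of the
survivors. -/
lemma Admissible.expand_of_lt_tau (hA : A.Admissible) {S : ℕ × Finset ℕ} (hS : S.2.Nonempty)
    (hτ : A.M < A.tau ((A.expand S).1 - 1)) : A.expand S = (S.1 + 1, A.children S.2) := by
  have hk : 0 < A.k := by have := hA.two_le_k; omega
  have hne := children_nonempty hk hS
  have h0 : A.passes (S.1 + 1) (A.children S.2) = 0 := by
    by_contra hn
    obtain ⟨m, hm⟩ := Nat.exists_eq_succ_of_ne_zero hn
    -- By minimality of the number of passes, the loop condition held one level above the sampled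
    -- nodes. There `τ > M ≥ 1` and a nonempty set contradict both of its alternatives.
    have h1 : m ∉ {n | ¬ A.KeepExpanding (S.1 + 1 + n) (A.children^[n] (A.children S.2))} :=
      Nat.notMem_of_lt_sInf (show m < A.passes (S.1 + 1) (A.children S.2) by omega)
    rw [expand_fst, hm] at hτ
    have h2 : S.1 + (m.succ + 1) - 1 = S.1 + 1 + m := by omega
    rw [h2] at hτ
    simp only [Set.mem_ofPred_eq, not_not, KeepExpanding] at h1
    have h3 : 1 ≤ (A.children^[m] (A.children S.2)).card :=
      (iterate_children_nonempty hk hne m).card_pos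
    have h4 : 1 * A.tau (S.1 + 1 + m) ≤
        (A.children^[m] (A.children S.2)).card * A.tau (S.1 + 1 + m) := Nat.mul_le_mul_right _ h3
    have := hA.one_le_M
    omega
  simp [expand, h0]

lemma expand_nonempty (hk : 0 < A.k) {S : ℕ × Finset ℕ} (hS : S.2.Nonempty) :
    (A.expand S).2.Nonempty := by
  rw [expand_snd]
  exact iterate_children_nonempty hk hS _

lemma isNode_expand {S : ℕ × Finset ℕ} (hS : ∀ i ∈ S.2, IsNode A.k S.1 i) :
    ∀ i ∈ (A.expand S).2, IsNode A.k (A.expand S).1 i := by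
  rw [expand_fst, expand_snd]
  exact isNode_iterate_children hS _

lemma card_le_pow {k h : ℕ} {K : Finset ℕ} (hK : ∀ i ∈ K, IsNode k h i) : K.card ≤ k ^ h := by
  have : K ⊆ Finset.Icc 1 (k ^ h) := fun i hi => Finset.mem_Icc.2 (hK i hi)
  simpa using Finset.card_le_card this

/-! ### Surviving and sampled nodes. -/

section Survivors

variable (y : Fin A.M → ℕ → ℕ → ℕ → ℝ)

lemma Admissible.eliminate_nonempty (hA : A.Admissible) {S : ℕ × Finset ℕ} (hS : S.2.Nonempty) :
    (A.eliminate y S).2.Nonempty := by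
  obtain ⟨i, hi, hmax⟩ := Finset.exists_max_image S.2 (fun i => A.estimate y S.1 i) hS
  refine ⟨i, ?_⟩
  simp only [eliminate, Finset.mem_filter]
  refine ⟨hi, ?_⟩
  rintro ⟨j, hj, -, hlt⟩
  have h1 := hmax j hj
  have h2 := hA.width_nonneg S.1
  have h3 : 0 < A.ν₁ * A.ρ ^ S.1 := mul_pos hA.ν₁_pos (pow_pos hA.ρ_pos _)
  linarith

lemma eliminate_subset (S : ℕ × Finset ℕ) : (A.eliminate y S).2 ⊆ S.2 := by
  simp only [eliminate]
  exact Finset.filter_subset _ _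

lemma Admissible.survivors_nonempty (hA : A.Admissible) (p : ℕ) :
    (A.survivors y p).2.Nonempty := by
  have hk : 0 < A.k := by have := hA.two_le_k; omega
  induction p with
  | zero => exact Finset.singleton_nonempty 1
  | succ p ih => exact hA.eliminate_nonempty y (expand_nonempty hk ih)

lemma isNode_survivors (p : ℕ) : ∀ i ∈ (A.survivors y p).2, IsNode A.k (A.survivors y p).1 i := by
  induction p with
  | zero =>
    intro i hi
    obtain rfl : i = 1 := by simpa [survivors] using hi
    exact isNode_root _
  | succ p ih =>
    intro i hi
    exact isNode_expand ih i (eliminate_subset y _ hi)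

/-- The depth and the nodes that are sampled in phase `p + 1`. -/
noncomputable def sampled (A : Params) (y : Fin A.M → ℕ → ℕ → ℕ → ℝ) (p : ℕ) : ℕ × Finset ℕ :=
  A.expand (A.survivors y p)

lemma survivors_succ (p : ℕ) : A.survivors y (p + 1) = A.eliminate y (A.sampled y p) := rfl

lemma survivors_succ_fst (p : ℕ) : (A.survivors y (p + 1)).1 = (A.sampled y p).1 := rfl

lemma isNode_sampled (p : ℕ) : ∀ i ∈ (A.sampled y p).2, IsNode A.k (A.sampled y p).1 i :=
  isNode_expand (isNode_survivors y p)

lemma Admissible.sampled_nonempty (hA : A.Admissible) (p : ℕ) : (A.sampled y p).2.Nonempty :=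
  expand_nonempty (by have := hA.two_le_k; omega) (hA.survivors_nonempty y p)

lemma sampled_fst_strictMono : StrictMono fun p => (A.sampled y p).1 :=
  strictMono_nat_of_lt_succ fun p => by
    have := lt_expand_fst (A := A) (A.survivors y (p + 1))
    rwa [survivors_succ_fst] at this

/-- The number of rounds of the first `p` phases. -/
noncomputable def rounds (A : Params) (y : Fin A.M → ℕ → ℕ → ℕ → ℝ) (p : ℕ) : ℕ :=
  ∑ q ∈ Finset.range p, (A.sampled y q).2.card * A.pulls (A.sampled y q).1

end Survivors

end Params

/-! ### Splitting the rounds into phases. -/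

/-- Bounding the sum of `G` over the first `T` entries of a concatenation of lists, given a bound
of `G` on each of the lists that are reached. -/
lemma sum_getD_flatMap_le {α : Type*} (L : ℕ → List α) (G : α → ℝ) (W : ℕ → ℝ) (s : ℝ) (x₀ : α)
    (hW : ∀ p, 0 ≤ W p) (n : ℕ) : ∀ T : ℕ,
    T ≤ ((List.range n).flatMap L).length →
    (∀ p < n, ((List.range p).flatMap L).length < T → ∀ x ∈ L p, G x ≤ W p + s) →
    ∑ t ∈ Finset.range T, G (((List.range n).flatMap L).getD t x₀) ≤
      ∑ p ∈ Finset.range n, (L p).length * W p + T * s := by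
  induction n with
  | zero =>
    intro T hT _
    obtain rfl : T = 0 := by simpa using hT
    simp
  | succ n ih =>
    intro T hT hG
    have hsplit : (List.range (n + 1)).flatMap L = (List.range n).flatMap L ++ L n := by
      simp [List.range_succ, List.flatMap_append]
    rw [hsplit] at hT ⊢
    set B := (List.range n).flatMap L with hB
    have hleft : ∀ t < B.length, (B ++ L n).getD t x₀ = B.getD t x₀ := fun t ht =>
      List.getD_append _ _ _ _ ht
    rw [Finset.sum_range_succ]
    have hlast : 0 ≤ (L n).length * W n := mul_nonneg (Nat.cast_nonneg _) (hW n)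
    by_cases hTB : T ≤ B.length
    · have h1 := ih T hTB fun p hp hlt => hG p (by omega) hlt
      rw [Finset.sum_congr rfl fun t ht => by
        rw [hleft t (lt_of_lt_of_le (Finset.mem_range.1 ht) hTB)]]
      linarith
    · push Not at hTB
      have h1 := ih B.length le_rfl fun p hp hlt => hG p (by omega) (hlt.trans hTB)
      have h2 : ∑ t ∈ Finset.range B.length, G ((B ++ L n).getD t x₀) =
          ∑ t ∈ Finset.range B.length, G (B.getD t x₀) :=
        Finset.sum_congr rfl fun t ht => by rw [hleft t (Finset.mem_range.1 ht)]
      rw [← Finset.sum_range_add_sum_Ico _ hTB.le, h2]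
      have h3 : ∑ t ∈ Finset.Ico B.length T, G ((B ++ L n).getD t x₀) ≤
          ∑ _t ∈ Finset.Ico B.length T, (W n + s) := by
        refine Finset.sum_le_sum fun t ht => hG n (by omega) hTB _ ?_
        obtain ⟨ht1, ht2⟩ := Finset.mem_Ico.1 ht
        rw [List.getD_append_right _ _ _ _ ht1]
        rw [List.length_append] at hT
        rw [List.getD_eq_getElem _ _ (by omega)]
        exact List.getElem_mem _
      rw [Finset.sum_const, Nat.card_Ico, nsmul_eq_mul] at h3
      have h4 : ((T - B.length : ℕ) : ℝ) = T - B.length := Nat.cast_sub hTB.le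
      -- Only part of the last list may be reached; since `W n ≥ 0`, it can be charged with its full
      -- length.
      have h5 : ((T - B.length : ℕ) : ℝ) ≤ (L n).length := by
        rw [List.length_append] at hT
        exact_mod_cast (by omega : T - B.length ≤ (L n).length)
      have h6 := mul_le_mul_of_nonneg_right h5 (hW n)
      rw [mul_add] at h3
      rw [h4] at h3 h6
      linarith

namespace Params

variable {A : Params}

section Phases

variable (y : Fin A.M → ℕ → ℕ → ℕ → ℝ) {order : Fin A.M → ℕ → Finset ℕ → List ℕ}

lemma length_phasePulls (horder : ∀ m h K, (order m h K).Perm K.toList) (m : Fin A.M) (p : ℕ) :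
    (A.phasePulls order y m p).length = (A.sampled y p).2.card * A.pulls (A.sampled y p).1 := by
  simp only [phasePulls, List.length_flatMap, List.length_replicate, List.map_const',
    List.sum_replicate, (horder _ _ _).length_eq, Finset.length_toList, smul_eq_mul]
  rfl

lemma length_flatMap_phasePulls (horder : ∀ m h K, (order m h K).Perm K.toList) (m : Fin A.M)
    (n : ℕ) : ((List.range n).flatMap (A.phasePulls order y m)).length = A.rounds y n := by
  induction n with
  | zero => simp [rounds]
  | succ n ih =>
    rw [List.range_succ, List.flatMap_append, List.length_append, ih, rounds, rounds,
      Finset.sum_range_succ]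
    simp [length_phasePulls y horder]

lemma mem_phasePulls (horder : ∀ m h K, (order m h K).Perm K.toList) {m : Fin A.M} {p : ℕ}
    {x : ℕ × ℕ} (hx : x ∈ A.phasePulls order y m p) :
    x.1 = (A.sampled y p).1 ∧ x.2 ∈ (A.sampled y p).2 := by
  simp only [phasePulls, List.mem_flatMap, List.mem_replicate] at hx
  obtain ⟨i, hi, -, rfl⟩ := hx
  rw [(horder _ _ _).mem_iff, Finset.mem_toList] at hi
  exact ⟨rfl, hi⟩

lemma rounds_succ (p : ℕ) : A.rounds y (p + 1) =
    A.rounds y p + (A.sampled y p).2.card * A.pulls (A.sampled y p).1 := by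
  simp [rounds, Finset.sum_range_succ]

lemma Admissible.rounds_lt (hA : A.Admissible) (p : ℕ) : A.rounds y p < A.rounds y (p + 1) := by
  rw [rounds_succ]
  have := Nat.mul_pos (hA.sampled_nonempty y p).card_pos (hA.pulls_pos (A.sampled y p).1)
  omega

lemma Admissible.le_rounds (hA : A.Admissible) (p : ℕ) : p ≤ A.rounds y p := by
  induction p with
  | zero => exact Nat.zero_le _
  | succ p ih => have := hA.rounds_lt y p; omega

/-- Each sampled node takes at least one round, which is what limits the number of estimates in the
union bound. -/
lemma Admissible.card_sampled_le (hA : A.Admissible) (p : ℕ) :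
    (A.rounds y p) + (A.sampled y p).2.card ≤ A.rounds y (p + 1) := by
  rw [rounds_succ]
  have := Nat.mul_le_mul_left (A.sampled y p).2.card (hA.pulls_pos (A.sampled y p).1)
  omega

/-- In every phase that is completed within the horizon, all estimates of the values `g` of the
sampled nodes are correct up to the confidence width. -/
def WellEstimated (A : Params) (y : Fin A.M → ℕ → ℕ → ℕ → ℝ) (g : ℕ → ℕ → ℝ) : Prop :=
  ∀ p, A.rounds y (p + 1) ≤ A.T → ∀ i ∈ (A.sampled y p).2,
    |A.estimate y (A.sampled y p).1 i - g (A.sampled y p).1 i| ≤ A.width (A.sampled y p).1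

end Phases

/-! ### Gaps of survivors and sampled nodes when the estimates are correct. -/

section Gaps

variable {X : Type*} {P : HierarchicalPartition X A.k} {f : X → ℝ} {l : X → X → ℝ}
  {y : Fin A.M → ℕ → ℕ → ℕ → ℝ}

/-- As long as the estimates are correct, an optimal node survives and all survivors are
near-optimal. -/
lemma Admissible.survivors_gap (hA : A.Admissible) (hf : BddAbove (Set.range f))
    (hs : LocallySmooth P f l A.ν₁ A.ρ) (hy : A.WellEstimated y fun h i => f (P.point h i))
    (p : ℕ) (hp : A.rounds y p ≤ A.T) :
    (∃ i ∈ (A.survivors y p).2, IsOptimalNode P f (A.survivors y p).1 i) ∧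
    ∀ i ∈ (A.survivors y p).2,
      (⨆ z, f z) - f (P.point (A.survivors y p).1 i) ≤ 6 * A.ν₁ * A.ρ ^ (A.survivors y p).1 := by
  have hk : 0 < A.k := by have := hA.two_le_k; omega
  have hν := hA.ν₁_pos
  have hρ := hA.ρ_pos
  induction p with
  | zero =>
    refine ⟨⟨1, Finset.mem_singleton_self 1, isOptimalNode_root⟩, fun i hi => ?_⟩
    obtain rfl : i = 1 := by simpa [survivors] using hi
    have := hs.gap_le_of_isOptimalNode hν hρ isOptimalNode_root (P.point_mem 0 1 (isNode_root _))
    simp only [survivors, pow_zero, mul_one] at this ⊢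
    linarith
  | succ p ih =>
    obtain ⟨hopt, -⟩ := ih ((hA.rounds_lt y p).le.trans hp)
    have hest := hy p hp
    obtain ⟨a, haS, haopt⟩ : ∃ i ∈ (A.sampled y p).2, IsOptimalNode P f (A.sampled y p).1 i := by
      rw [sampled, expand_fst, expand_snd]
      exact exists_optimal_iterate_children hk hopt _
    rw [survivors_succ]
    simp only [eliminate, Finset.mem_filter, not_exists, not_and, not_lt]
    generalize A.sampled y p = S at *
    have hw := hA.width_le S.1
    have hga := hs.gap_le_of_isOptimalNode hν hρ haopt (P.point_mem _ _ haopt.1)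
    have hea := abs_le.1 (hest a haS)
    refine ⟨⟨a, ⟨haS, fun j hj _ => ?_⟩, haopt⟩, ?_⟩
    -- The slack `ν₁ ρ ^ h` of the elimination rule makes up for the gap of the representative of
    -- `a`, so its upper bound is at least `f*`, which no correct lower bound exceeds.
    · have hej := abs_le.1 (hest j hj)
      have hfj : f (P.point S.1 j) ≤ ⨆ z, f z := le_ciSup hf _
      linarith [hea.1, hej.2]
    -- Comparison with `a`: the gap of `i` is at most the gap of `a`, plus the slack, plus four
    -- widths (two of the rule, two of estimation), each of the six at most `ν₁ ρ ^ h`.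
    · rintro i ⟨hi, hsurv⟩
      obtain ⟨j, hj, hmax⟩ := Finset.exists_max_image S.2 (fun i => A.estimate y S.1 i) ⟨a, haS⟩
      have h1 := hsurv j hj hmax
      have h2 := hmax a haS
      have hei := abs_le.1 (hest i hi)
      linarith [hea.1, hei.2]

/-- However many levels the inner loop skips, a sampled cell lies in the cell of a survivor, so the
bound is in terms of the depth of the survivors. -/
lemma Admissible.sampled_gap (hA : A.Admissible) (hf : BddAbove (Set.range f))
    (hs : LocallySmooth P f l A.ν₁ A.ρ) (hy : A.WellEstimated y fun h i => f (P.point h i))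
    (p : ℕ) (hp : A.rounds y p ≤ A.T) (i : ℕ) (hi : i ∈ (A.sampled y p).2) :
    (⨆ z, f z) - f (P.point (A.sampled y p).1 i) ≤ 12 * A.ν₁ * A.ρ ^ (A.survivors y p).1 := by
  have hnode := isNode_sampled y p i hi
  have hsub : ∃ i' ∈ (A.survivors y p).2,
      P.cell (A.sampled y p).1 i ⊆ P.cell (A.survivors y p).1 i' := by
    rw [sampled, expand_snd] at hi
    rw [sampled, expand_fst]
    exact exists_ancestor P (isNode_survivors y p) _ i hi
  obtain ⟨i', hi', hsub⟩ := hsub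
  exact hs.gap_le_of_point hA.ν₁_pos hA.ρ_pos (isNode_survivors y p i' hi')
    ((hA.survivors_gap hf hs hy p hp).2 i' hi') (hsub (P.point_mem _ _ hnode))

lemma Admissible.card_survivors_le (hA : A.Admissible) (hf : BddAbove (Set.range f))
    (hs : LocallySmooth P f l A.ν₁ A.ρ) (hy : A.WellEstimated y fun h i => f (P.point h i))
    {C d : ℝ} (hdim : NearOptimalityDim P f A.ν₁ A.ρ C d) (p : ℕ) (hp : A.rounds y p ≤ A.T) :
    ((A.survivors y p).2.card : ℝ) ≤ C * (A.ρ ^ (A.survivors y p).1) ^ (-d) := by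
  classical
  refine le_trans ?_ (hdim (A.survivors y p).1)
  refine Nat.cast_le.2 (Finset.card_le_card fun i hi => ?_)
  rw [Finset.mem_filter]
  exact ⟨Finset.mem_Icc.2 (isNode_survivors y p i hi), (hA.survivors_gap hf hs hy p hp).2 i hi⟩

end Gaps

/-! ### Cost of a single phase. -/

/-- The two nested ceilings amount to one, since `⌈⌈x⌉ / M⌉ ≤ ⌈x / M⌉`; rounding thus costs at most
one pull per client. -/
lemma Admissible.M_mul_pulls_le (hA : A.Admissible) (h : ℕ) :
    (A.M : ℝ) * A.pulls h ≤ A.scale h + A.M := by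
  have hM : (0 : ℝ) < A.M := by exact_mod_cast hA.one_le_M
  have h1 : A.pulls h ≤ ⌈A.scale h / A.M⌉₊ := by
    refine Nat.ceil_le.2 ?_
    rw [div_le_iff₀ hM]
    have h2 : A.scale h / A.M ≤ ⌈A.scale h / A.M⌉₊ := Nat.le_ceil _
    rw [div_le_iff₀ hM] at h2
    have h3 : A.tau h ≤ ⌈A.scale h / A.M⌉₊ * A.M := Nat.ceil_le.2 (by exact_mod_cast h2)
    exact_mod_cast h3
  have h4 : (A.pulls h : ℝ) ≤ ⌈A.scale h / A.M⌉₊ := by exact_mod_cast h1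
  have h5 := (Nat.ceil_lt_add_one (div_nonneg (hA.scale_pos h).le hM.le)).le
  calc (A.M : ℝ) * A.pulls h ≤ A.M * (A.scale h / A.M + 1) := by
        exact mul_le_mul_of_nonneg_left (h4.trans h5) hM.le
    _ = _ := by field_simp

lemma Admissible.scale_le_of_tau_le {h : ℕ} (hτ : A.tau h ≤ A.M) : A.scale h ≤ A.M :=
  (Nat.le_ceil _).trans (Nat.cast_le.2 hτ)

lemma lt_scale_of_lt_tau {h : ℕ} (hτ : A.M < A.tau h) : (A.M : ℝ) < A.scale h := Nat.lt_ceil.1 hτ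

/-- An upper bound of the regret of a phase of depth `j + 1`, where depths beyond `n` do not count
if `τ_j > M`. -/
noncomputable def phaseCost (A : Params) (C d : ℝ) (n j : ℕ) : ℝ :=
  if A.tau j ≤ A.M then 24 * A.ν₁ / A.ρ ^ 2 * A.M * A.k ^ (j + 1)
  else if j < n then
    24 * A.k * C * A.c ^ 2 * Real.log (A.c₁ * A.T / A.δ) / (A.ν₁ * A.ρ ^ 2) *
      (A.ρ ^ j) ^ (-(d + 1))
  else 0

lemma Admissible.phaseCost_nonneg (hA : A.Admissible) {C : ℝ} (hC : 0 ≤ C) (d : ℝ) (n j : ℕ) :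
    0 ≤ A.phaseCost C d n j := by
  have hc := hA.c_pos; have hν := hA.ν₁_pos; have hρ := hA.ρ_pos; have hL := hA.log_pos
  unfold phaseCost
  split_ifs <;> positivity

/-- The gap that is accounted for in a phase of depth `H` after survivors of depth `h`. -/
noncomputable def phaseGap (A : Params) (n h H : ℕ) : ℝ :=
  if A.M < A.tau (H - 1) ∧ n ≤ H - 1 then 0 else 12 * A.ν₁ * A.ρ ^ h

lemma Admissible.phaseGap_nonneg (hA : A.Admissible) (n h H : ℕ) : 0 ≤ A.phaseGap n h H := by
  have hν := hA.ν₁_pos; have hρ := hA.ρ_pos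
  unfold phaseGap
  split_ifs <;> positivity

section Cost

variable {X : Type*} {P : HierarchicalPartition X A.k} {f : X → ℝ} {l : X → X → ℝ}
  {y : Fin A.M → ℕ → ℕ → ℕ → ℝ}

/-- A gap that is not charged to its phase belongs to survivors exactly one level above the sampled
nodes, hence at depth at least `n`; the charge per round covers it. -/
lemma Admissible.gap_le_phaseGap (hA : A.Admissible) (n p : ℕ) :
    12 * A.ν₁ * A.ρ ^ (A.survivors y p).1 ≤
      A.phaseGap n (A.survivors y p).1 (A.sampled y p).1 + 12 * A.ν₁ * A.ρ ^ n := by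
  have hν := hA.ν₁_pos; have hρ := hA.ρ_pos
  unfold phaseGap
  split_ifs with h
  · have h1 := hA.expand_of_lt_tau (hA.survivors_nonempty y p) h.1
    have h2 := h.2
    rw [sampled, h1, Nat.add_sub_cancel] at h2
    rw [zero_add]
    gcongr ?_ * ?_
    exact pow_le_pow_of_le_one hρ.le hA.ρ_lt_one.le h2
  · have : 0 ≤ 12 * A.ν₁ * A.ρ ^ n := by positivity
    linarith

/-- The pulls of a node by all clients number at most `scale + M`. Below the threshold both summands
are at most `M ρ⁻²`, above it both are at most `scale`; this doubles the 12 of the gap to 24. -/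
lemma Admissible.cost_le_phaseCost (hA : A.Admissible) (hf : BddAbove (Set.range f))
    (hs : LocallySmooth P f l A.ν₁ A.ρ) (hy : A.WellEstimated y fun h i => f (P.point h i))
    {C d : ℝ} (hdim : NearOptimalityDim P f A.ν₁ A.ρ C d) (n p : ℕ)
    (hp : A.rounds y p ≤ A.T) :
    A.M * (((A.sampled y p).2.card * A.pulls (A.sampled y p).1 : ℕ) *
      A.phaseGap n (A.survivors y p).1 (A.sampled y p).1) ≤
      A.phaseCost C d n ((A.sampled y p).1 - 1) := by
  have hc := hA.c_pos; have hν := hA.ν₁_pos; have hρ := hA.ρ_pos; have hL := hA.log_pos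
  have hM : (0 : ℝ) < A.M := by exact_mod_cast hA.one_le_M
  have hlt : (A.survivors y p).1 < (A.sampled y p).1 := lt_expand_fst _
  have hpull := hA.M_mul_pulls_le (A.sampled y p).1
  have hH : (A.sampled y p).1 - 1 + 1 = (A.sampled y p).1 := by omega
  have hscale : A.scale (A.sampled y p).1 = A.scale ((A.sampled y p).1 - 1) * (A.ρ ^ 2)⁻¹ := by
    rw [← hA.scale_succ, hH]
  have hone := hA.one_le_inv_sq
  push_cast
  unfold phaseCost
  split_ifs with h1 h2
  · have hgap : A.phaseGap n (A.survivors y p).1 (A.sampled y p).1 ≤ 12 * A.ν₁ := by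
      unfold phaseGap
      split_ifs
      · positivity
      · exact mul_le_of_le_one_right (by positivity) (pow_le_one₀ hρ.le hA.ρ_lt_one.le)
    have hcard : ((A.sampled y p).2.card : ℝ) ≤ (A.k : ℝ) ^ (A.sampled y p).1 := by
      exact_mod_cast card_le_pow (isNode_sampled y p)
    have hsc := Admissible.scale_le_of_tau_le h1
    have hMt : (A.M : ℝ) * A.pulls (A.sampled y p).1 ≤ 2 * (A.M * (A.ρ ^ 2)⁻¹) := by
      have h3 : A.scale ((A.sampled y p).1 - 1) * (A.ρ ^ 2)⁻¹ ≤ A.M * (A.ρ ^ 2)⁻¹ := by gcongr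
      have h4 : (A.M : ℝ) ≤ A.M * (A.ρ ^ 2)⁻¹ := le_mul_of_one_le_right hM.le hone
      linarith
    calc _ = (A.sampled y p).2.card * (A.M * A.pulls (A.sampled y p).1) *
          A.phaseGap n (A.survivors y p).1 (A.sampled y p).1 := by ring
      _ ≤ (A.k : ℝ) ^ (A.sampled y p).1 * (2 * (A.M * (A.ρ ^ 2)⁻¹)) * (12 * A.ν₁) := by
          gcongr
          exact hA.phaseGap_nonneg _ _ _
      _ = _ := by rw [hH]; field_simp; ring
  · push Not at h1
    have hexp := hA.expand_of_lt_tau (hA.survivors_nonempty y p) h1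
    have hs1 : (A.sampled y p).1 = (A.survivors y p).1 + 1 := by rw [sampled, hexp]
    have hs2 : (A.sampled y p).2 = A.children (A.survivors y p).2 := by rw [sampled, hexp]
    have hcard : ((A.sampled y p).2.card : ℝ) ≤
        A.k * (C * (A.ρ ^ (A.survivors y p).1) ^ (-d)) := by
      rw [hs2]
      calc _ ≤ ((A.k * (A.survivors y p).2.card : ℕ) : ℝ) := by
            exact_mod_cast card_children_le _
        _ = A.k * ((A.survivors y p).2.card : ℝ) := by push_cast; ring
        _ ≤ _ := by
            gcongr
            exact hA.card_survivors_le hf hs hy hdim p hp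
    have hgap : A.phaseGap n (A.survivors y p).1 (A.sampled y p).1 =
        12 * A.ν₁ * A.ρ ^ (A.survivors y p).1 := by
      unfold phaseGap
      rw [if_neg]
      omega
    have hMt : (A.M : ℝ) * A.pulls (A.sampled y p).1 ≤ 2 * A.scale (A.sampled y p).1 := by
      have := lt_scale_of_lt_tau h1
      have h3 := hA.scale_mono (show (A.sampled y p).1 - 1 ≤ (A.sampled y p).1 by omega)
      linarith
    rw [hgap]
    calc _ = (A.sampled y p).2.card * (A.M * A.pulls (A.sampled y p).1) *
          (12 * A.ν₁ * A.ρ ^ (A.survivors y p).1) := by ring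
      _ ≤ A.k * (C * (A.ρ ^ (A.survivors y p).1) ^ (-d)) * (2 * A.scale (A.sampled y p).1) *
          (12 * A.ν₁ * A.ρ ^ (A.survivors y p).1) := by
          gcongr
          exact (Nat.cast_nonneg _).trans hcard
      _ = _ := by
          rw [hs1, Nat.add_sub_cancel, scale, mul_add, pow_add, pow_mul', neg_add,
            Real.rpow_add (by positivity), Real.rpow_neg_one]
          field_simp
          ring
  · push Not at h1 h2
    have hgap : A.phaseGap n (A.survivors y p).1 (A.sampled y p).1 = 0 := by
      unfold phaseGap
      rw [if_pos ⟨h1, h2⟩]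
    rw [hgap]
    simp

lemma Admissible.regret_le_sum_phaseCost (hA : A.Admissible) (hf : BddAbove (Set.range f))
    (hs : LocallySmooth P f l A.ν₁ A.ρ) (hy : A.WellEstimated y fun h i => f (P.point h i))
    {C d : ℝ} (hC : 0 ≤ C) (hdim : NearOptimalityDim P f A.ν₁ A.ρ C d)
    {order : Fin A.M → ℕ → Finset ℕ → List ℕ}
    (horder : ∀ m h K, (order m h K).Perm K.toList) (n : ℕ) :
    ∃ J, A.regret P f order y ≤
      ∑ j ∈ Finset.range J, A.phaseCost C d n j + 12 * A.ν₁ * (A.M * A.T) * A.ρ ^ n := by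
  classical
  have hν := hA.ν₁_pos; have hρ := hA.ρ_pos
  -- Phases that begin after the horizon contribute nothing, and no gap bound is available for them.
  set W : ℕ → ℝ := fun p => if A.rounds y p ≤ A.T then
    A.phaseGap n (A.survivors y p).1 (A.sampled y p).1 else 0 with hW
  have hW0 : ∀ p, 0 ≤ W p := fun p => by
    simp only [hW]
    split_ifs
    · exact hA.phaseGap_nonneg _ _ _
    · exact le_rfl
  set g : ℕ × ℕ → ℝ := fun x => (⨆ x, f x) - f (P.point x.1 x.2) with hg
  have hclient : ∀ m : Fin A.M, ∑ t ∈ Finset.range A.T, g (A.nodeAt order y m t) ≤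
      ∑ p ∈ Finset.range A.T, ((A.sampled y p).2.card * A.pulls (A.sampled y p).1 : ℕ) * W p +
        A.T * (12 * A.ν₁ * A.ρ ^ n) := by
    intro m
    have h1 := sum_getD_flatMap_le (A.phasePulls order y m) g W (12 * A.ν₁ * A.ρ ^ n) (0, 1) hW0
      A.T A.T
      (by rw [length_flatMap_phasePulls y horder]; exact hA.le_rounds y _) ?_
    · simp only [length_phasePulls y horder] at h1
      exact h1
    · intro p _ hlt x hx
      rw [length_flatMap_phasePulls y horder] at hlt
      obtain ⟨hx1, hx2⟩ := mem_phasePulls y horder hx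
      simp only [hW, if_pos hlt.le, hg]
      rw [hx1]
      exact (hA.sampled_gap hf hs hy p hlt.le _ hx2).trans (hA.gap_le_phaseGap n p)
  -- The sampled depths are positive and distinct, so the shift by one is injective and each index
  -- is charged at most once.
  have hinj : Set.InjOn (fun p => (A.sampled y p).1 - 1) (Finset.range A.T : Set ℕ) := by
    intro p _ q _ hpq
    have h1 : (A.survivors y p).1 < (A.sampled y p).1 := lt_expand_fst _
    have h2 : (A.survivors y q).1 < (A.sampled y q).1 := lt_expand_fst _
    refine (sampled_fst_strictMono y).injective ?_
    simp only at hpq ⊢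
    omega
  obtain ⟨J, hJ⟩ : ∃ J, (Finset.range A.T).image (fun p => (A.sampled y p).1 - 1) ⊆
      Finset.range J := ⟨_, Finset.subset_range_sup_succ _⟩
  refine ⟨J, ?_⟩
  calc A.regret P f order y = ∑ m, ∑ t ∈ Finset.range A.T, g (A.nodeAt order y m t) := rfl
    _ ≤ ∑ _m : Fin A.M, (∑ p ∈ Finset.range A.T,
          ((A.sampled y p).2.card * A.pulls (A.sampled y p).1 : ℕ) * W p +
          A.T * (12 * A.ν₁ * A.ρ ^ n)) := Finset.sum_le_sum fun m _ => hclient m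
    _ = ∑ p ∈ Finset.range A.T, A.M * (((A.sampled y p).2.card *
          A.pulls (A.sampled y p).1 : ℕ) * W p) + 12 * A.ν₁ * (A.M * A.T) * A.ρ ^ n := by
        rw [Finset.sum_const, Finset.card_univ, Fintype.card_fin, nsmul_eq_mul, mul_add,
          Finset.mul_sum]
        ring
    _ ≤ ∑ p ∈ Finset.range A.T, A.phaseCost C d n ((A.sampled y p).1 - 1) +
          12 * A.ν₁ * (A.M * A.T) * A.ρ ^ n := by
        gcongr with p _
        by_cases hp : A.rounds y p ≤ A.T
        · simp only [hW, if_pos hp]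
          exact hA.cost_le_phaseCost hf hs hy hdim n p hp
        · simp only [hW, if_neg hp, mul_zero]
          exact hA.phaseCost_nonneg hC _ _ _
    _ = ∑ j ∈ (Finset.range A.T).image (fun p => (A.sampled y p).1 - 1), A.phaseCost C d n j +
          12 * A.ν₁ * (A.M * A.T) * A.ρ ^ n := by
        rw [Finset.sum_image hinj]
    _ ≤ _ := by
        gcongr
        exact fun j _ _ => hA.phaseCost_nonneg hC _ _ _

end Cost

end Params

/-! ### Summation over the depths and choice of the cut-off depth. -/

/-- A sum of distinct powers of `k ≥ 2`, each at most `N`, is at most `2 N`. -/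
lemma sum_pow_le_two_mul {k : ℕ} (hk : 2 ≤ k) {N : ℝ} (hN : 0 ≤ N) (s : Finset ℕ)
    (hs : ∀ j ∈ s, (k : ℝ) ^ j ≤ N) : ∑ j ∈ s, (k : ℝ) ^ j ≤ 2 * N := by
  have hk' : (2 : ℝ) ≤ k := by exact_mod_cast hk
  rcases s.eq_empty_or_nonempty with rfl | hne
  · simpa using hN
  have hgeom : ∀ m : ℕ, ∑ j ∈ Finset.range (m + 1), (k : ℝ) ^ j ≤ 2 * (k : ℝ) ^ m := by
    intro m
    induction m with
    | zero => norm_num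
    | succ m ih =>
      rw [Finset.sum_range_succ]
      have : (2 : ℝ) * (k : ℝ) ^ m ≤ k ^ (m + 1) := by
        rw [pow_succ']
        gcongr
      linarith
  have hsub : s ⊆ Finset.range (s.max' hne + 1) := fun j hj =>
    Finset.mem_range.2 (Nat.lt_succ_of_le (s.le_max' j hj))
  calc _ ≤ ∑ j ∈ Finset.range (s.max' hne + 1), (k : ℝ) ^ j :=
        Finset.sum_le_sum_of_subset_of_nonneg hsub fun _ _ _ => by positivity
    _ ≤ 2 * (k : ℝ) ^ (s.max' hne) := hgeom _
    _ ≤ _ := by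
        have := hs _ (s.max'_mem hne)
        linarith

/-- Balancing the terms `D q ^ (-(d + 1))` and `E q` over the powers `q` of `ρ`. -/
lemma exists_pow_balance {ρ D E d : ℝ} (hρ₀ : 0 < ρ) (hρ₁ : ρ < 1) (hD : 0 < D) (hE : 0 < E)
    (hd : 0 ≤ d) : ∃ n : ℕ, D * ((ρ ^ n) ^ (-(d + 1)) - 1) + E * ρ ^ n ≤
      2 * (ρ ^ (-(d + 2)) * (E ^ (d + 1) * D)) ^ (1 / (d + 2)) := by
  have hd2 : 0 < d + 2 := by linarith
  -- The real `q` at which `D q ^ (-(d + 1)) = E q`. Rounding it to a power of `ρ` loses at most a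
  -- factor `ρ⁻¹`.
  set q := (D / E) ^ (1 / (d + 2)) with hq
  have hq0 : 0 < q := by positivity
  have hqpow : q ^ (d + 2) = D / E := by
    rw [hq, ← Real.rpow_mul (by positivity), one_div, inv_mul_cancel₀ hd2.ne', Real.rpow_one]
  have hDq : D = E * q ^ (d + 2) := by rw [hqpow]; field_simp
  have hbal : D * q ^ (-(d + 1)) = E * q := by
    rw [hDq, mul_assoc, ← Real.rpow_add hq0, show d + 2 + -(d + 1) = 1 by ring, Real.rpow_one]
  have hE2 : E ^ (d + 2) = E ^ (d + 1) * E := by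
    rw [← Real.rpow_add_one hE.ne']
    ring_nf
  have hR : (ρ ^ (-(d + 2)) * (E ^ (d + 1) * D)) ^ (1 / (d + 2)) = ρ⁻¹ * (E * q) := by
    have h1 : ρ ^ (-(d + 2)) * (E ^ (d + 1) * D) = (ρ⁻¹ * (E * q)) ^ (d + 2) := by
      rw [Real.mul_rpow (by positivity) (by positivity), Real.mul_rpow hE.le hq0.le,
        Real.inv_rpow hρ₀.le, Real.rpow_neg hρ₀.le, hqpow, hE2, mul_assoc (E ^ (d + 1)),
        mul_div_cancel₀ D hE.ne']
    rw [h1, ← Real.rpow_mul (by positivity), mul_one_div_cancel hd2.ne', Real.rpow_one]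
  rw [hR]
  have hEq : 0 < E * q := by positivity
  have hinv : 1 ≤ ρ⁻¹ := (one_le_inv₀ hρ₀).2 hρ₁.le
  have hle : E * q ≤ ρ⁻¹ * (E * q) := le_mul_of_one_le_left hEq.le hinv
  rcases le_or_gt 1 q with h1 | h1
  -- Here `q` lies beyond all powers of `ρ`. With `n = 0` the first term vanishes, thanks to the `-
  -- 1` in it.
  · refine ⟨0, ?_⟩
    have h2 : E ≤ E * q := le_mul_of_one_le_right hE.le h1
    simp only [pow_zero, Real.one_rpow, sub_self, mul_zero, zero_add, mul_one]
    linarith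
  · obtain ⟨n, hn1, hn2⟩ := exists_nat_pow_near_of_lt_one hq0 h1.le hρ₀ hρ₁
    refine ⟨n, ?_⟩
    have h2 : (ρ ^ n) ^ (-(d + 1)) ≤ q ^ (-(d + 1)) :=
      Real.rpow_le_rpow_of_nonpos hq0 hn2 (by linarith)
    have h3 : D * (ρ ^ n) ^ (-(d + 1)) ≤ E * q := by
      rw [← hbal]
      gcongr
    have h4 : E * ρ ^ n ≤ ρ⁻¹ * (E * q) := by
      rw [pow_succ] at hn1
      rw [inv_mul_eq_div, le_div_iff₀ hρ₀]
      nlinarith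
    linarith

namespace Params

variable {A : Params}

/-- The threshold gives `ρ ^ (-2 j) ≤ M / scale 0`; the exponent `a` is the one with `ρ ^ (-2 a) =
k`. -/
lemma Admissible.pow_le_of_tau_le (hA : A.Admissible) {j : ℕ} (hj : A.tau j ≤ A.M) :
    (A.k : ℝ) ^ j ≤ (A.M / A.scale 0) ^ (-(1 / (2 * Real.logb A.k A.ρ))) := by
  have hρ := hA.ρ_pos
  have hk : (1 : ℝ) < A.k := by exact_mod_cast hA.two_le_k
  have hlogk := Real.log_pos hk
  have hlogρ := Real.log_neg hρ hA.ρ_lt_one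
  have h0 := hA.scale_pos 0
  set a := -(1 / (2 * Real.logb A.k A.ρ)) with ha
  have ha' : a = -Real.log A.k / (2 * Real.log A.ρ) := by
    rw [ha, Real.logb]
    field_simp
  have ha0 : 0 ≤ a := by
    rw [ha']
    exact div_nonneg_of_nonpos (by linarith) (by linarith)
  have h1 : (A.ρ ^ (2 * j))⁻¹ ≤ A.M / A.scale 0 := by
    rw [le_div_iff₀ h0]
    refine le_of_eq_of_le ?_ (Admissible.scale_le_of_tau_le hj)
    simp only [scale, mul_zero, pow_zero, inv_one, mul_one]
    ring
  have h2 : ((A.ρ ^ (2 * j))⁻¹) ^ a = (A.k : ℝ) ^ j := by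
    rw [Real.rpow_def_of_pos (by positivity), Real.log_inv, Real.log_pow, ha',
      ← Real.exp_log (show (0 : ℝ) < (A.k : ℝ) ^ j by positivity), Real.log_pow]
    congr 1
    push_cast
    have := hlogρ.ne
    field_simp
  rw [← h2]
  exact Real.rpow_le_rpow (by positivity) h1 ha0

/-- Two geometric sums: powers of `k`, dominated by the largest, and powers of `ρ ^ (-(d + 1))`,
evaluated exactly to keep the `- 1` that the balancing needs. -/
lemma Admissible.sum_phaseCost_le (hA : A.Admissible) {C d : ℝ} (hC : 0 ≤ C) (hd : 0 ≤ d)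
    (n J : ℕ) : ∑ j ∈ Finset.range J, A.phaseCost C d n j ≤
      48 * A.k * A.ν₁ / A.ρ ^ 2 * A.M *
        (A.M / A.scale 0) ^ (-(1 / (2 * Real.logb A.k A.ρ))) +
      24 * A.k * C * A.c ^ 2 * Real.log (A.c₁ * A.T / A.δ) /
        (A.ν₁ * A.ρ ^ 2 * (A.ρ ^ (-(d + 1)) - 1)) * ((A.ρ ^ n) ^ (-(d + 1)) - 1) := by
  classical
  have hc := hA.c_pos; have hν := hA.ν₁_pos; have hρ := hA.ρ_pos; have hL := hA.log_pos
  have h0 := hA.scale_pos 0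
  have hb : 1 < A.ρ ^ (-(d + 1)) :=
    Real.one_lt_rpow_of_pos_of_lt_one_of_neg hρ hA.ρ_lt_one (by linarith)
  set N := (A.M / A.scale 0) ^ (-(1 / (2 * Real.logb A.k A.ρ))) with hN
  set K := 24 * A.k * C * A.c ^ 2 * Real.log (A.c₁ * A.T / A.δ) / (A.ν₁ * A.ρ ^ 2) with hK
  have hK0 : 0 ≤ K := by positivity
  have hN0 : 0 ≤ N := by positivity
  have hterm : ∀ j, A.phaseCost C d n j ≤
      (if A.tau j ≤ A.M then 24 * A.ν₁ / A.ρ ^ 2 * A.M * A.k * (A.k : ℝ) ^ j else 0) +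
      (if j < n then K * (A.ρ ^ j) ^ (-(d + 1)) else 0) := by
    intro j
    have hpos : 0 ≤ K * (A.ρ ^ j) ^ (-(d + 1)) := by positivity
    unfold phaseCost
    rw [pow_succ (A.k : ℝ) j]
    split_ifs
    · linarith
    · linarith
    · linarith
    · linarith
  have hsum1 : ∑ j ∈ Finset.range J,
      (if A.tau j ≤ A.M then 24 * A.ν₁ / A.ρ ^ 2 * A.M * A.k * (A.k : ℝ) ^ j else 0) ≤
      48 * A.k * A.ν₁ / A.ρ ^ 2 * A.M * N := by
    rw [← Finset.sum_filter, ← Finset.mul_sum]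
    have := sum_pow_le_two_mul hA.two_le_k hN0 ((Finset.range J).filter fun j => A.tau j ≤ A.M)
      fun j hj => hA.pow_le_of_tau_le (Finset.mem_filter.1 hj).2
    calc _ ≤ 24 * A.ν₁ / A.ρ ^ 2 * A.M * A.k * (2 * N) := by gcongr
      _ = _ := by ring
  have hsum2 : ∑ j ∈ Finset.range J, (if j < n then K * (A.ρ ^ j) ^ (-(d + 1)) else 0) ≤
      K / (A.ρ ^ (-(d + 1)) - 1) * ((A.ρ ^ n) ^ (-(d + 1)) - 1) := by
    rw [← Finset.sum_filter]
    calc _ ≤ ∑ j ∈ Finset.range n, K * (A.ρ ^ j) ^ (-(d + 1)) := by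
          refine Finset.sum_le_sum_of_subset_of_nonneg (fun j hj => ?_) fun _ _ _ => by positivity
          exact Finset.mem_range.2 (Finset.mem_filter.1 hj).2
      _ = K * ∑ j ∈ Finset.range n, (A.ρ ^ (-(d + 1))) ^ j := by
          rw [← Finset.mul_sum]
          simp_rw [Real.rpow_pow_comm hρ.le]
      _ = _ := by
          rw [geom_sum_eq hb.ne', Real.rpow_pow_comm hρ.le]
          ring
  calc _ ≤ _ := Finset.sum_le_sum fun j _ => hterm j
    _ ≤ 48 * A.k * A.ν₁ / A.ρ ^ 2 * A.M * N +
          K / (A.ρ ^ (-(d + 1)) - 1) * ((A.ρ ^ n) ^ (-(d + 1)) - 1) := by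
        rw [Finset.sum_add_distrib]
        exact add_le_add hsum1 hsum2
    _ = _ := by rw [hK, div_div]

/-- The regret bound that holds whenever all estimates are correct. -/
theorem Admissible.regret_le (hA : A.Admissible) (hT : 1 ≤ A.T) {X : Type*}
    {P : HierarchicalPartition X A.k} {f : X → ℝ} {l : X → X → ℝ}
    {y : Fin A.M → ℕ → ℕ → ℕ → ℝ} (hf : BddAbove (Set.range f))
    (hs : LocallySmooth P f l A.ν₁ A.ρ) (hy : A.WellEstimated y fun h i => f (P.point h i))
    {C d : ℝ} (hC : 0 < C) (hd : 0 ≤ d) (hdim : NearOptimalityDim P f A.ν₁ A.ρ C d)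
    {order : Fin A.M → ℕ → Finset ℕ → List ℕ}
    (horder : ∀ m h K, (order m h K).Perm K.toList) :
    A.regret P f order y ≤
      48 * A.k * A.ν₁ / A.ρ ^ 2 * A.M *
        (A.M / A.scale 0) ^ (-(1 / (2 * Real.logb A.k A.ρ))) +
      2 * (24 * A.k * C * A.c ^ 2 * A.ρ ^ (-(d + 4)) * (12 * A.ν₁) ^ (d + 1) /
        (A.ν₁ * (A.ρ ^ (-(d + 1)) - 1)) * (((A.M : ℝ) * A.T) ^ (d + 1) *
          Real.log (A.c₁ * A.T / A.δ))) ^ (1 / (d + 2)) := by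
  have hc := hA.c_pos; have hν := hA.ν₁_pos; have hρ := hA.ρ_pos; have hL := hA.log_pos
  have hM : (0 : ℝ) < A.M := by exact_mod_cast hA.one_le_M
  have hT' : (0 : ℝ) < A.T := by exact_mod_cast hT
  have hk : (0 : ℝ) < A.k := by exact_mod_cast (show 0 < A.k by have := hA.two_le_k; omega)
  have hb : 0 < A.ρ ^ (-(d + 1)) - 1 := by
    have := Real.one_lt_rpow_of_pos_of_lt_one_of_neg hρ hA.ρ_lt_one
      (show -(d + 1) < 0 by linarith)
    linarith
  obtain ⟨n, hn⟩ := exists_pow_balance hρ hA.ρ_lt_one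
    (D := 24 * A.k * C * A.c ^ 2 * Real.log (A.c₁ * A.T / A.δ) /
        (A.ν₁ * A.ρ ^ 2 * (A.ρ ^ (-(d + 1)) - 1)))
    (E := 12 * A.ν₁ * (A.M * A.T)) (by positivity) (by positivity) hd
  obtain ⟨J, hJ⟩ := hA.regret_le_sum_phaseCost hf hs hy hC.le hdim horder n
  have hsum := hA.sum_phaseCost_le hC.le hd n J
  refine hJ.trans ?_
  have heq : A.ρ ^ (-(d + 2)) * ((12 * A.ν₁ * (A.M * A.T)) ^ (d + 1) *
      (24 * A.k * C * A.c ^ 2 * Real.log (A.c₁ * A.T / A.δ) /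
        (A.ν₁ * A.ρ ^ 2 * (A.ρ ^ (-(d + 1)) - 1)))) =
      24 * A.k * C * A.c ^ 2 * A.ρ ^ (-(d + 4)) * (12 * A.ν₁) ^ (d + 1) /
        (A.ν₁ * (A.ρ ^ (-(d + 1)) - 1)) * (((A.M : ℝ) * A.T) ^ (d + 1) *
          Real.log (A.c₁ * A.T / A.δ)) := by
    -- The factor `ρ ^ (-(d + 2))` comes from rounding in the balance, `ρ⁻²` from passing from
    -- `scale j` to `scale (j + 1)`.
    have h4 : A.ρ ^ (-(d + 4)) = A.ρ ^ (-(d + 2)) * (A.ρ ^ 2)⁻¹ := by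
      rw [← Real.rpow_natCast A.ρ 2, ← Real.rpow_neg hρ.le, ← Real.rpow_add hρ]
      congr 1
      push_cast
      ring
    rw [h4, Real.mul_rpow (by positivity) (by positivity)]
    field_simp
  rw [heq] at hn
  linarith

end Params

/-! ### Concentration of a single estimate. -/

open scoped NNReal

/-- A centered Gaussian random variable is sub-Gaussian with its variance as parameter. -/
lemma hasSubgaussianMGF_of_map_eq_gaussianReal {Ω : Type*} [MeasurableSpace Ω] {μ : Measure Ω}
    {X : Ω → ℝ} {v : ℝ≥0} (hX : Measurable X) (h : μ.map X = gaussianReal 0 v) :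
    HasSubgaussianMGF X v μ := by
  rw [← HasSubgaussianMGF.id_map_iff hX.aemeasurable, h]
  refine ⟨fun t => integrable_exp_mul_gaussianReal t, fun t => ?_⟩
  rw [mgf_gaussianReal (p := gaussianReal 0 v) (X := id) (μ := 0) (v := v) (by simp)]
  simp

/-- The family of all rewards (first component `true`) and noises (first component `false`). -/
noncomputable def samples {Ω : Type*} {k M : ℕ} (r z : Fin M → ℕ → ℕ → ℕ → Ω → ℝ)
    (a : Bool × Fin M × {n : ℕ × ℕ // IsNode k n.1 n.2} × ℕ) : Ω → ℝ :=
  if a.1 then r a.2.1 a.2.2.1.1.1 a.2.2.1.1.2 a.2.2.2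
  else z a.2.1 a.2.2.1.1.1 a.2.2.1.1.2 a.2.2.2

namespace Environment

variable {X Ω : Type*} [MeasurableSpace Ω] {k M : ℕ} {P : HierarchicalPartition X k}
  {floc : Fin M → X → ℝ} {v : ℝ} {μ : Measure Ω} {r z : Fin M → ℕ → ℕ → ℕ → Ω → ℝ}

lemma measurable_samples (henv : Environment P floc v μ r z)
    (a : Bool × Fin M × {n : ℕ × ℕ // IsNode k n.1 n.2} × ℕ) : Measurable (samples r z a) := by
  unfold samples
  split_ifs
  · exact henv.reward_measurable _ _ _ _ a.2.2.1.2
  · exact henv.noise_measurable _ _ _ _ a.2.2.1.2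

lemma iIndepFun_samples (henv : Environment P floc v μ r z) :
    iIndepFun (samples (k := k) r z) μ := henv.indep

/-- The sum of the centered noisy rewards of `t` pulls of a node by every client is sub-Gaussian. -/
lemma hasSubgaussianMGF_sum [IsProbabilityMeasure μ] (henv : Environment P floc v μ r z)
    {h i : ℕ} (hi : IsNode k h i) (t : ℕ) :
    HasSubgaussianMGF (fun ω => ∑ m : Fin M, ∑ s ∈ Finset.range t,
      (r m h i s ω + z m h i s ω - floc m (P.point h i))) ((M * t : ℕ) * (1 / 4 + v.toNNReal)) μ := by
  classical
  set G : (Bool × Fin M × {n : ℕ × ℕ // IsNode k n.1 n.2} × ℕ) → Ω → ℝ := fun a ω =>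
    samples r z a ω - if a.1 then floc a.2.1 (P.point a.2.2.1.1.1 a.2.2.1.1.2) else 0 with hG
  have hindep : iIndepFun G μ :=
    henv.iIndepFun_samples.comp
      (fun a x => x - if a.1 then floc a.2.1 (P.point a.2.2.1.1.1 a.2.2.1.1.2) else 0)
      fun a => measurable_id.sub_const _
  set c : (Bool × Fin M × {n : ℕ × ℕ // IsNode k n.1 n.2} × ℕ) → ℝ≥0 := fun a =>
    if a.1 then 1 / 4 else v.toNNReal with hc
  have hsub : ∀ a, HasSubgaussianMGF (G a) (c a) μ := by
    rintro ⟨b, m, n, s⟩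
    cases b
    · simp only [hG, hc, samples, Bool.false_eq_true, if_false, sub_zero]
      exact hasSubgaussianMGF_of_map_eq_gaussianReal (henv.noise_measurable _ _ _ _ n.2)
        (henv.noise_law _ _ _ _ n.2)
    · have h1 := hasSubgaussianMGF_of_mem_Icc
        (henv.reward_measurable m n.1.1 n.1.2 s n.2).aemeasurable
        (henv.reward_mem m n.1.1 n.1.2 s n.2)
      rw [henv.reward_mean m n.1.1 n.1.2 s n.2] at h1
      have h2 : ((‖(1 : ℝ) - 0‖₊ / 2) ^ 2 : ℝ≥0) = 1 / 4 := by
        rw [sub_zero, nnnorm_one]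
        norm_num
      rw [h2] at h1
      simpa only [hG, hc, samples, if_true] using h1
  -- Centered rewards (parameter `1/4`, Hoeffding) and noises (parameter `v`) are summed as one
  -- independent family; the parameters add up.
  have key := HasSubgaussianMGF.sum_of_iIndepFun hindep (c := c)
    (s := Finset.univ ×ˢ Finset.univ ×ˢ {⟨(h, i), hi⟩} ×ˢ Finset.range t) fun a _ => hsub a
  convert! key using 2
  · simp only [Finset.sum_product, Fintype.sum_bool, Finset.sum_singleton, hG, samples, if_true,
      Bool.false_eq_true, if_false, sub_zero]
    rw [← Finset.sum_add_distrib]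
    refine Finset.sum_congr rfl fun m _ => ?_
    rw [← Finset.sum_add_distrib]
    exact Finset.sum_congr rfl fun s _ => by ring
  · simp only [Finset.sum_product, Fintype.sum_bool, Finset.sum_singleton, hc, if_true,
      Bool.false_eq_true, if_false, Finset.sum_const, Finset.card_univ, Fintype.card_fin,
      Finset.card_range, nsmul_eq_mul]
    push_cast
    ring

lemma measure_deviation_le [IsProbabilityMeasure μ] (henv : Environment P floc v μ r z)
    (hv : 0 ≤ v) {h i : ℕ} (hi : IsNode k h i) {t : ℕ} (ht : 0 < t) (hM : 0 < M) {w : ℝ}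
    (hw : 0 ≤ w) :
    μ {ω | w < |(∑ m, (∑ s ∈ Finset.range t, (r m h i s ω + z m h i s ω)) / t) / M -
      globalObj floc (P.point h i)|} ≤
      ENNReal.ofReal (2 * Real.exp (-((M * t : ℕ) * w ^ 2) / (2 * (1 / 4 + v)))) := by
  have hM' : (0 : ℝ) < M := by exact_mod_cast hM
  have ht' : (0 : ℝ) < t := by exact_mod_cast ht
  set D : Ω → ℝ := fun ω => ∑ m : Fin M, ∑ s ∈ Finset.range t,
      (r m h i s ω + z m h i s ω - floc m (P.point h i)) with hD
  have hsub : HasSubgaussianMGF D _ μ := henv.hasSubgaussianMGF_sum hi t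
  have heq : ∀ ω, (∑ m, (∑ s ∈ Finset.range t, (r m h i s ω + z m h i s ω)) / t) / M -
      globalObj floc (P.point h i) = D ω / (M * t) := by
    intro ω
    simp only [hD, globalObj, Finset.sum_sub_distrib, Finset.sum_const, Finset.card_range,
      nsmul_eq_mul, ← Finset.mul_sum, ← Finset.sum_div]
    field_simp
  have hε : 0 ≤ w * (M * t) := by positivity
  have h1 := hsub.measure_ge_le hε
  have h2 := hsub.neg.measure_ge_le hε
  have hexp : -(w * (M * t)) ^ 2 / (2 * (((M * t : ℕ) * (1 / 4 + v.toNNReal) : ℝ≥0) : ℝ)) =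
      -((M * t : ℕ) * w ^ 2) / (2 * (1 / 4 + v)) := by
    push_cast
    rw [Real.coe_toNNReal v hv]
    field_simp
  rw [hexp] at h1 h2
  have hcover : {ω | w < |(∑ m, (∑ s ∈ Finset.range t, (r m h i s ω + z m h i s ω)) / t) / M -
      globalObj floc (P.point h i)|} ⊆
      {ω | w * (M * t) ≤ D ω} ∪ {ω | w * (M * t) ≤ (-D) ω} := by
    intro ω hω
    simp only [Set.mem_ofPred_eq, heq] at hω
    rw [abs_div, abs_of_pos (show (0 : ℝ) < M * t by positivity), lt_div_iff₀ (by positivity)] at hω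
    rcases lt_abs.1 hω with h' | h'
    · exact Or.inl h'.le
    · exact Or.inr h'.le
  refine (ENNReal.le_ofReal_iff_toReal_le (measure_ne_top _ _) (by positivity)).2 ?_
  have h3 := measureReal_mono (μ := μ) hcover (measure_ne_top _ _)
  have h4 := measureReal_union_le (μ := μ) {ω | w * (M * t) ≤ D ω} {ω | w * (M * t) ≤ (-D) ω}
  simp only [Measure.real] at h1 h2 h3 h4 ⊢
  linarith

end Environment

/-! ### Measurability of the run of the algorithm. -/

namespace Params

variable {A : Params}

section Measurability

variable {Ω : Type*} [MeasurableSpace Ω] {y : Ω → Fin A.M → ℕ → ℕ → ℕ → ℝ}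

lemma measurable_estimate {h i : ℕ} (hy : ∀ m s, Measurable fun ω => y ω m h i s) :
    Measurable fun ω => A.estimate (y ω) h i := by
  unfold estimate
  exact (Finset.measurable_sum _ fun m _ =>
    (Finset.measurable_sum _ fun s _ => hy m s).div_const _).div_const _

/-- Only the samples of nodes in `S` need be measurable, so that the σ-algebra may be one generated
by part of the samples. -/
lemma measurableSet_eliminate_eq {S : ℕ × Finset ℕ}
    (hy : ∀ i ∈ S.2, ∀ m s, Measurable fun ω => y ω m S.1 i s) (S' : ℕ × Finset ℕ) :
    MeasurableSet {ω | A.eliminate (y ω) S = S'} := by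
  have hest : ∀ i ∈ S.2, Measurable fun ω => A.estimate (y ω) S.1 i := fun i hi =>
    measurable_estimate (hy i hi)
  suffices hm : Measurable fun ω => A.eliminate (y ω) S from hm (measurableSet_singleton S')
  refine Measurable.prodMk measurable_const (measurable_finset_iff.2 fun a => ?_)
  refine measurableSet_setOfPred.1 ?_
  simp only [Finset.mem_filter]
  by_cases ha : a ∈ S.2
  · simp only [ha, true_and]
    have heq : {ω | ¬ ∃ j ∈ S.2, (∀ i' ∈ S.2, A.estimate (y ω) S.1 i' ≤ A.estimate (y ω) S.1 j) ∧
        A.estimate (y ω) S.1 a + A.width S.1 + A.ν₁ * A.ρ ^ S.1 <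
          A.estimate (y ω) S.1 j - A.width S.1} =
        (⋃ j ∈ S.2, (⋂ i' ∈ S.2, {ω | A.estimate (y ω) S.1 i' ≤ A.estimate (y ω) S.1 j}) ∩
          {ω | A.estimate (y ω) S.1 a + A.width S.1 + A.ν₁ * A.ρ ^ S.1 <
            A.estimate (y ω) S.1 j - A.width S.1})ᶜ := by
      ext ω
      simp
    rw [heq]
    refine (MeasurableSet.biUnion S.2.countable_toSet fun j hj =>
      (MeasurableSet.biInter S.2.countable_toSet fun i' hi' => ?_).inter ?_).compl
    · exact measurableSet_le (hest i' hi') (hest j hj)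
    · exact measurableSet_lt (((hest a ha).add_const _).add_const _) ((hest j hj).sub_const _)
  · simp [ha]

/-- The survivors at depths below `H`, and the number of rounds up to then, depend on the noisy
rewards at depths below `H` only. -/
lemma measurableSet_survivors_eq {H : ℕ}
    (hy : ∀ h i, h < H → IsNode A.k h i → ∀ m s, Measurable fun ω => y ω m h i s) (p : ℕ) :
    ∀ (S : ℕ × Finset ℕ) (n : ℕ), S.1 < H →
      MeasurableSet {ω | A.survivors (y ω) p = S ∧ A.rounds (y ω) p = n} := by
  induction p with
  | zero =>
    intro S n _
    simp only [survivors, rounds, Finset.range_zero, Finset.sum_empty]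
    exact MeasurableSet.const _
  | succ p ih =>
    intro S n hS
    -- Countable decomposition over the previous state. Restricting `S'` to genuine nodes whose
    -- expansion has depth `S.1` is what makes `hy` applicable.
    have heq : {ω | A.survivors (y ω) (p + 1) = S ∧ A.rounds (y ω) (p + 1) = n} =
        ⋃ S' ∈ {S' : ℕ × Finset ℕ | (A.expand S').1 = S.1 ∧ ∀ i ∈ S'.2, IsNode A.k S'.1 i},
        ⋃ n' ∈ {n' : ℕ | n' + (A.expand S').2.card * A.pulls (A.expand S').1 = n},
          {ω | A.survivors (y ω) p = S' ∧ A.rounds (y ω) p = n'} ∩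
            {ω | A.eliminate (y ω) (A.expand S') = S} := by
      ext ω
      simp only [Set.mem_iUnion, Set.mem_inter_iff, Set.mem_ofPred_eq, exists_prop]
      constructor
      · rintro ⟨h1, h2⟩
        refine ⟨A.survivors (y ω) p, ⟨?_, isNode_survivors _ p⟩, A.rounds (y ω) p, ?_,
          ⟨rfl, rfl⟩, h1⟩
        · rw [← h1]
          rfl
        · rw [← h2, rounds_succ]
          rfl
      · rintro ⟨S', -, n', hn', ⟨h1, h2⟩, h3⟩
        rw [rounds_succ, survivors_succ, sampled, h1, h2]
        exact ⟨h3, hn'⟩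
    rw [heq]
    refine MeasurableSet.biUnion (Set.to_countable _) fun S' hS' =>
      MeasurableSet.biUnion (Set.to_countable _) fun n' _ => ?_
    obtain ⟨h1, h2⟩ := hS'
    refine (ih S' n' ?_).inter (measurableSet_eliminate_eq (fun i hi => ?_) S)
    · have := lt_expand_fst (A := A) S'
      omega
    · exact hy _ _ (by omega) (isNode_expand h2 i hi)

/-- The event that `S` is sampled in phase `p + 1` and that this phase is completed within the
horizon depends on the noisy rewards at depths below that of `S` only. -/
lemma measurableSet_sampled_eq {S : ℕ × Finset ℕ}
    (hy : ∀ h i, h < S.1 → IsNode A.k h i → ∀ m s, Measurable fun ω => y ω m h i s) (p : ℕ) :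
    MeasurableSet {ω | A.sampled (y ω) p = S ∧ A.rounds (y ω) (p + 1) ≤ A.T} := by
  have heq : {ω | A.sampled (y ω) p = S ∧ A.rounds (y ω) (p + 1) ≤ A.T} =
      ⋃ S' ∈ {S' : ℕ × Finset ℕ | A.expand S' = S},
      ⋃ n ∈ {n : ℕ | n + S.2.card * A.pulls S.1 ≤ A.T},
        {ω | A.survivors (y ω) p = S' ∧ A.rounds (y ω) p = n} := by
    ext ω
    simp only [Set.mem_iUnion, Set.mem_ofPred_eq, exists_prop, rounds_succ]
    constructor
    · rintro ⟨h1, h2⟩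
      exact ⟨_, h1, A.rounds (y ω) p, by rwa [h1] at h2, rfl, rfl⟩
    · rintro ⟨S', h1, n, h2, h3, h4⟩
      rw [sampled, h3, h4, h1]
      exact ⟨rfl, h2⟩
  rw [heq]
  refine MeasurableSet.biUnion (Set.to_countable _) fun S' hS' =>
    MeasurableSet.biUnion (Set.to_countable _) fun n _ => measurableSet_survivors_eq hy p S' n ?_
  rw [← (show A.expand S' = S from hS')]
  exact lt_expand_fst S'

lemma measurable_survivors (hy : ∀ h i, IsNode A.k h i → ∀ m s, Measurable fun ω => y ω m h i s)
    (p : ℕ) : Measurable fun ω => A.survivors (y ω) p := by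
  refine measurable_to_countable' fun S => ?_
  have heq : (fun ω => A.survivors (y ω) p) ⁻¹' {S} =
      ⋃ n, {ω | A.survivors (y ω) p = S ∧ A.rounds (y ω) p = n} := by
    ext ω
    simp
  rw [heq]
  exact MeasurableSet.iUnion fun n =>
    measurableSet_survivors_eq (H := S.1 + 1) (fun h i _ => hy h i) p S n (Nat.lt_succ_self _)

/-- The regret is a function of the first `T` survivor sets, which take values in a countable
discrete space; nothing is needed of `f` or `order`. -/
lemma measurable_regret (hy : ∀ h i, IsNode A.k h i → ∀ m s, Measurable fun ω => y ω m h i s)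
    {X : Type*} {k : ℕ} (P : HierarchicalPartition X k) (f : X → ℝ)
    (order : Fin A.M → ℕ → Finset ℕ → List ℕ) :
    Measurable fun ω => A.regret P f order (y ω) := by
  set φ : (Fin A.T → ℕ × Finset ℕ) → Fin A.M → ℕ → ℕ × ℕ := fun a m t =>
    ((List.finRange A.T).flatMap fun p => (order m (A.expand (a p)).1 (A.expand (a p)).2).flatMap
      fun i => List.replicate (A.pulls (A.expand (a p)).1) ((A.expand (a p)).1, i)).getD t (0, 1)
    with hφ
  have hnode : ∀ ω m t, A.nodeAt order (y ω) m t =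
      φ (fun p => A.survivors (y ω) p) m t := by
    intro ω m t
    simp only [nodeAt, hφ]
    rw [← List.map_coe_finRange_eq_range, List.flatMap_map]
    rfl
  have heq : (fun ω => A.regret P f order (y ω)) =
      (fun a : Fin A.T → ℕ × Finset ℕ => ∑ m, ∑ t ∈ Finset.range A.T,
        ((⨆ x, f x) - f (P.point (φ a m t).1 (φ a m t).2))) ∘
        fun ω => fun p : Fin A.T => A.survivors (y ω) p := by
    funext ω
    simp only [regret, hnode, Function.comp]
  rw [heq]
  exact (measurable_of_countable _).comp
    (measurable_pi_lambda _ fun p => measurable_survivors hy p)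

end Measurability

/-- The horizon is the bound of interest; the bound by `rounds` is carried along for the induction.
-/
lemma Admissible.sum_card_sampled_le (hA : A.Admissible) (y : Fin A.M → ℕ → ℕ → ℕ → ℝ) (n : ℕ) :
    ∑ p ∈ Finset.range n, (if A.rounds y (p + 1) ≤ A.T then (A.sampled y p).2.card else 0) ≤
      min (A.rounds y n) A.T := by
  induction n with
  | zero => simp
  | succ n ih =>
    rw [Finset.sum_range_succ]
    have h1 := hA.card_sampled_le y n
    have h2 := hA.rounds_lt y n
    split_ifs <;> omega

/-! ### Union bound over the adaptively sampled nodes. -/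

section UnionBound

variable {X Ω : Type*} [MeasurableSpace Ω] {P : HierarchicalPartition X A.k}
  {floc : Fin A.M → X → ℝ} {v : ℝ} {μ : Measure Ω} {r z : Fin A.M → ℕ → ℕ → ℕ → Ω → ℝ}

open scoped ENNReal

/-- The sampled nodes are chosen independently of their own rewards and noises. -/
lemma measure_sampled_inter_deviation (henv : Environment P floc v μ r z) (p : ℕ)
    {S : ℕ × Finset ℕ} {i : ℕ} (hi : IsNode A.k S.1 i) (w : ℝ) :
    μ ({ω | A.sampled (fun m h i s => r m h i s ω + z m h i s ω) p = S ∧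
          A.rounds (fun m h i s => r m h i s ω + z m h i s ω) (p + 1) ≤ A.T} ∩
        {ω | w < |A.estimate (fun m h i s => r m h i s ω + z m h i s ω) S.1 i -
          globalObj floc (P.point S.1 i)|}) =
      μ {ω | A.sampled (fun m h i s => r m h i s ω + z m h i s ω) p = S ∧
          A.rounds (fun m h i s => r m h i s ω + z m h i s ω) (p + 1) ≤ A.T} *
        μ {ω | w < |A.estimate (fun m h i s => r m h i s ω + z m h i s ω) S.1 i -
          globalObj floc (P.point S.1 i)|} := by
  set 𝓢 : (Bool × Fin A.M × {n : ℕ × ℕ // IsNode A.k n.1 n.2} × ℕ) → MeasurableSpace Ω := fun a =>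
    MeasurableSpace.comap (samples r z a) inferInstance with h𝓢
  have hdisj : Disjoint
      {a : Bool × Fin A.M × {n : ℕ × ℕ // IsNode A.k n.1 n.2} × ℕ | a.2.2.1.1.1 < S.1}
      {a | a.2.2.1.1.1 = S.1} := by
    rw [Set.disjoint_left]
    intro a h1 h2
    simp only [Set.mem_ofPred_eq] at h1 h2
    omega
  have hind := indep_iSup_of_disjoint (fun a => (henv.measurable_samples a).comap_le)
    henv.iIndepFun_samples.iIndep hdisj
  have hmeas : ∀ (𝓑 : Set (Bool × Fin A.M × {n : ℕ × ℕ // IsNode A.k n.1 n.2} × ℕ)) (a),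
      a ∈ 𝓑 → Measurable[⨆ b ∈ 𝓑, 𝓢 b] (samples r z a) := fun 𝓑 a ha =>
    (comap_measurable (samples r z a)).mono (le_biSup 𝓢 ha) le_rfl
  refine (Indep_iff _ _ _).1 hind _ _ ?_ ?_
  · refine @measurableSet_sampled_eq A Ω (_) _ S (fun h i hh hi m s => ?_) p
    exact (hmeas {a | a.2.2.1.1.1 < S.1} (true, m, ⟨(h, i), hi⟩, s) hh).add
      (hmeas {a | a.2.2.1.1.1 < S.1} (false, m, ⟨(h, i), hi⟩, s) hh)
  · have hest := @measurable_estimate A Ω (⨆ b ∈ {a | a.2.2.1.1.1 = S.1}, 𝓢 b)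
      (fun ω m h i s => r m h i s ω + z m h i s ω) S.1 i (fun m s =>
        (hmeas {a | a.2.2.1.1.1 = S.1} (true, m, ⟨(S.1, i), hi⟩, s) rfl).add
          (hmeas {a | a.2.2.1.1.1 = S.1} (false, m, ⟨(S.1, i), hi⟩, s) rfl))
    have hdev : Measurable[⨆ b ∈ {a | a.2.2.1.1.1 = S.1}, 𝓢 b] fun ω =>
        |A.estimate (fun m h i s => r m h i s ω + z m h i s ω) S.1 i -
          globalObj floc (P.point S.1 i)| :=
      continuous_abs.measurable.comp (hest.sub_const _)
    exact hdev measurableSet_Ioi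

/-- If every single estimate is off by more than its confidence width with probability at most `q`,
then some estimate made within the horizon is with probability at most `T q`. -/
lemma Admissible.measure_not_wellEstimated_le (hA : A.Admissible) [IsProbabilityMeasure μ]
    (henv : Environment P floc v μ r z) {q : ℝ≥0∞}
    (hq : ∀ h i, IsNode A.k h i →
      μ {ω | A.width h < |A.estimate (fun m h i s => r m h i s ω + z m h i s ω) h i -
          globalObj floc (P.point h i)|} ≤ q) :
    μ {ω | ¬ A.WellEstimated (fun m h i s => r m h i s ω + z m h i s ω)
      fun h i => globalObj floc (P.point h i)} ≤ A.T * q := by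
  set y : Ω → Fin A.M → ℕ → ℕ → ℕ → ℝ := fun ω m h i s => r m h i s ω + z m h i s ω with hy
  have hymeas : ∀ h i, IsNode A.k h i → ∀ m s, Measurable fun ω => y ω m h i s :=
    fun h i hi m s => (henv.reward_measurable m h i s hi).add (henv.noise_measurable m h i s hi)
  set E : ℕ → ℕ × Finset ℕ → Set Ω := fun p S =>
    {ω | A.sampled (y ω) p = S ∧ A.rounds (y ω) (p + 1) ≤ A.T} with hE
  have hEmeas : ∀ p S, MeasurableSet (E p S) := fun p S =>
    measurableSet_sampled_eq (fun h i _ => hymeas h i) p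
  set D : ℕ → ℕ → Set Ω := fun h i =>
    {ω | A.width h < |A.estimate (y ω) h i - globalObj floc (P.point h i)|} with hD
  have hcover : {ω | ¬ A.WellEstimated (y ω) fun h i => globalObj floc (P.point h i)} ⊆
      ⋃ p ∈ Finset.range A.T, ⋃ S : ℕ × Finset ℕ, ⋃ i ∈ S.2, E p S ∩ D S.1 i := by
    intro ω hω
    simp only [Set.mem_ofPred_eq, WellEstimated, not_forall, not_le] at hω
    obtain ⟨p, hp, i, hi, hlt⟩ := hω
    have := hA.le_rounds (y ω) (p + 1)
    simp only [Set.mem_iUnion, Finset.mem_range]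
    exact ⟨p, by omega, A.sampled (y ω) p, i, hi, ⟨rfl, hp⟩, hlt⟩
  have hterm : ∀ p S, ∀ i ∈ S.2, μ (E p S ∩ D S.1 i) ≤ μ (E p S) * q := by
    intro p S i hi
    -- A set `S` that is sampled for some `ω` consists of genuine nodes; for any other `S` the event
    -- is empty.
    by_cases hne : (E p S).Nonempty
    · obtain ⟨ω, hω⟩ := hne
      have hnode : IsNode A.k S.1 i := by
        have h1 : A.sampled (y ω) p = S := hω.1
        have := isNode_sampled (y ω) p
        rw [h1] at this
        exact this i hi
      calc μ (E p S ∩ D S.1 i) = μ (E p S) * μ (D S.1 i) :=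
            measure_sampled_inter_deviation henv p hnode _
        _ ≤ _ := by
            gcongr
            exact hq _ _ hnode
    · rw [Set.not_nonempty_iff_eq_empty.1 hne]
      simp
  -- The left side is the expected number of nodes sampled in completed phases.
  have hcount : ∑ p ∈ Finset.range A.T, ∑' S : ℕ × Finset ℕ, (S.2.card : ℝ≥0∞) * μ (E p S) ≤
      A.T := by
    have h1 : ∀ p, ∑' S : ℕ × Finset ℕ, (S.2.card : ℝ≥0∞) * μ (E p S) =
        ∫⁻ ω, ∑' S : ℕ × Finset ℕ, (E p S).indicator (fun _ => (S.2.card : ℝ≥0∞)) ω ∂μ := by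
      intro p
      rw [lintegral_tsum fun S => (measurable_const.indicator (hEmeas p S)).aemeasurable]
      exact tsum_congr fun S => (lintegral_indicator_const (hEmeas p S) _).symm
    have h2 : ∀ p ω, ∑' S : ℕ × Finset ℕ, (E p S).indicator (fun _ => (S.2.card : ℝ≥0∞)) ω =
        ((if A.rounds (y ω) (p + 1) ≤ A.T then (A.sampled (y ω) p).2.card else 0 : ℕ) : ℝ≥0∞) := by
      intro p ω
      rw [tsum_eq_single (A.sampled (y ω) p)]
      · by_cases hp : A.rounds (y ω) (p + 1) ≤ A.T
        · rw [Set.indicator_of_mem (show ω ∈ E p (A.sampled (y ω) p) from ⟨rfl, hp⟩), if_pos hp]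
        · rw [Set.indicator_of_notMem (fun h' => hp h'.2), if_neg hp, Nat.cast_zero]
      · intro S hS
        exact Set.indicator_of_notMem (fun h' => hS h'.1.symm) _
    simp_rw [h1]
    rw [← lintegral_finsetSum _ fun p _ => Measurable.tsum fun S =>
      measurable_const.indicator (hEmeas p S)]
    simp_rw [h2]
    calc _ ≤ ∫⁻ _ω, (A.T : ℝ≥0∞) ∂μ := by
          refine lintegral_mono fun ω => ?_
          rw [← Nat.cast_sum]
          exact Nat.cast_le.2 ((hA.sum_card_sampled_le (y ω) A.T).trans (min_le_right _ _))
      _ = A.T := by simp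
  calc μ {ω | ¬ A.WellEstimated (y ω) fun h i => globalObj floc (P.point h i)}
      ≤ μ (⋃ p ∈ Finset.range A.T, ⋃ S : ℕ × Finset ℕ, ⋃ i ∈ S.2, E p S ∩ D S.1 i) :=
        measure_mono hcover
    _ ≤ ∑ p ∈ Finset.range A.T, μ (⋃ S : ℕ × Finset ℕ, ⋃ i ∈ S.2, E p S ∩ D S.1 i) :=
        measure_biUnion_finset_le _ _
    _ ≤ ∑ p ∈ Finset.range A.T, ∑' S : ℕ × Finset ℕ, (S.2.card : ℝ≥0∞) * μ (E p S) * q := by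
        gcongr with p _
        refine (measure_iUnion_le _).trans (ENNReal.tsum_le_tsum fun S => ?_)
        refine (measure_biUnion_finset_le _ _).trans ?_
        refine (Finset.sum_le_card_nsmul _ _ _ (hterm p S)).trans_eq ?_
        rw [nsmul_eq_mul, mul_assoc]
    _ = (∑ p ∈ Finset.range A.T, ∑' S : ℕ × Finset ℕ, (S.2.card : ℝ≥0∞) * μ (E p S)) * q := by
        rw [Finset.sum_mul]
        simp_rw [ENNReal.tsum_mul_right]
    _ ≤ A.T * q := by gcongr

end UnionBound

end Params

/-! ### Trivial bounds on gaps, regret and `C`. -/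

lemma globalObj_mem_Icc {X : Type*} {M : ℕ} {floc : Fin M → X → ℝ}
    (hfloc : ∀ m x, floc m x ∈ Set.Icc (0 : ℝ) 1) (x : X) :
    globalObj floc x ∈ Set.Icc (0 : ℝ) 1 := by
  have h0 : 0 ≤ ∑ m, floc m x := Finset.sum_nonneg fun m _ => (hfloc m x).1
  have h1 : ∑ m, floc m x ≤ M := by
    calc _ ≤ ∑ _m : Fin M, (1 : ℝ) := Finset.sum_le_sum fun m _ => (hfloc m x).2
      _ = M := by simp
  exact ⟨div_nonneg h0 (Nat.cast_nonneg _), div_le_one_of_le₀ h1 (Nat.cast_nonneg _)⟩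

lemma LocallySmooth.gap_le {X : Type*} {k : ℕ} {P : HierarchicalPartition X k} {f : X → ℝ}
    {l : X → X → ℝ} {ν₁ ρ : ℝ} (hs : LocallySmooth P f l ν₁ ρ) (hν : 0 < ν₁) (hρ : 0 < ρ) (x : X) :
    (⨆ z, f z) - f x ≤ ν₁ := by
  have hx : x ∈ P.cell 0 1 := by rw [P.cell_root]; trivial
  simpa using hs.gap_le_of_isOptimalNode hν hρ isOptimalNode_root hx

/-- At depth 0 the root itself is counted, as its gap is at most `ν₁`. -/
lemma NearOptimalityDim.one_le {X : Type*} {k : ℕ} {P : HierarchicalPartition X k} {f : X → ℝ}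
    {l : X → X → ℝ} {ν₁ ρ C d : ℝ} (hdim : NearOptimalityDim P f ν₁ ρ C d)
    (hs : LocallySmooth P f l ν₁ ρ) (hν : 0 < ν₁) (hρ : 0 < ρ) : 1 ≤ C := by
  classical
  have h0 := hdim 0
  have h1 : (⨆ z, f z) - f (P.point 0 1) ≤ 6 * ν₁ := by
    have := hs.gap_le hν hρ (P.point 0 1)
    linarith
  simp only [pow_zero, mul_one, Finset.Icc_self, Finset.filter_singleton, if_pos h1] at h0
  simpa using h0

namespace Params

variable {A : Params} {X : Type*} {k : ℕ} {P : HierarchicalPartition X k} {f : X → ℝ}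
  {order : Fin A.M → ℕ → Finset ℕ → List ℕ} {y : Fin A.M → ℕ → ℕ → ℕ → ℝ}

lemma regret_nonneg (hf : BddAbove (Set.range f)) : 0 ≤ A.regret P f order y :=
  Finset.sum_nonneg fun _ _ => Finset.sum_nonneg fun _ _ => sub_nonneg.2 (le_ciSup hf _)

lemma regret_le_of_gap_le {b : ℝ} (hb : ∀ x, (⨆ z, f z) - f x ≤ b) :
    A.regret P f order y ≤ A.M * A.T * b := by
  calc A.regret P f order y ≤ ∑ _m : Fin A.M, ∑ _t ∈ Finset.range A.T, b :=
        Finset.sum_le_sum fun _ _ => Finset.sum_le_sum fun _ _ => hb _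
    _ = _ := by simp [mul_assoc]

end Params

/-! ### The constants of the private algorithm. -/

section Constants

variable {k M T : ℕ} {ν₁ ρ ε C d : ℝ}

lemma log_confidence_pos (hM : 1 ≤ M) : 0 < Real.log (1.25 / (1 / (M : ℝ))) := by
  have hM' : (1 : ℝ) ≤ M := by exact_mod_cast hM
  refine Real.log_pos ?_
  rw [div_div_eq_mul_div, div_one]
  linarith

lemma noiseVar_nonneg (hM : 1 ≤ M) : 0 ≤ noiseVar ε (1 / (M : ℝ)) := by
  have := log_confidence_pos hM
  unfold noiseVar
  positivity

lemma dpParams_c_sq (hM : 1 ≤ M) :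
    (dpParams k M T ν₁ ρ ε).c ^ 2 = 4 + 16 * noiseVar ε (1 / (M : ℝ)) := by
  have := noiseVar_nonneg (ε := ε) hM
  exact Real.sq_sqrt (by linarith)

lemma dpParams_c_sq_eq_div (hM : 1 ≤ M) (hε : 0 < ε) : (dpParams k M T ν₁ ρ ε).c ^ 2 =
    (4 * ε ^ 2 + 32 * Real.log (1.25 / (1 / (M : ℝ)))) / ε ^ 2 := by
  rw [dpParams_c_sq hM, noiseVar]
  field_simp
  ring

lemma dpParams_log (hM : 1 ≤ M) (hT : 1 ≤ T) :
    Real.log ((dpParams k M T ν₁ ρ ε).c₁ * (dpParams k M T ν₁ ρ ε).T / (dpParams k M T ν₁ ρ ε).δ) =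
      1 / 8 * Real.log (2 * M) + Real.log (M * T) := by
  have hM' : (0 : ℝ) < M := by exact_mod_cast hM
  have hT' : (0 : ℝ) < T := by exact_mod_cast hT
  simp only [dpParams]
  rw [div_div_eq_mul_div, div_one, mul_assoc, Real.log_mul (by positivity) (by positivity),
    Real.log_rpow (by positivity), mul_comm (T : ℝ)]

lemma log_two_mul_pos (hM : 1 ≤ M) : 0 < Real.log (2 * (M : ℝ)) := by
  have hM' : (1 : ℝ) ≤ M := by exact_mod_cast hM
  exact Real.log_pos (by linarith)

lemma log_mul_nonneg (hM : 1 ≤ M) (hT : 1 ≤ T) : 0 ≤ Real.log ((M : ℝ) * T) := by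
  have hM' : (1 : ℝ) ≤ M := by exact_mod_cast hM
  have hT' : (1 : ℝ) ≤ T := by exact_mod_cast hT
  exact Real.log_nonneg (one_le_mul_of_one_le_of_one_le hM' hT')

lemma dpParams_admissible (hk : 2 ≤ k) (hM : 1 ≤ M) (hT : 1 ≤ T) (hν : 0 < ν₁) (hρ₀ : 0 < ρ)
    (hρ₁ : ρ < 1) : (dpParams k M T ν₁ ρ ε).Admissible where
  two_le_k := hk
  one_le_M := hM
  ν₁_pos := hν
  ρ_pos := hρ₀
  ρ_lt_one := hρ₁
  c_pos := by
    have := noiseVar_nonneg (ε := ε) hM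
    exact Real.sqrt_pos.2 (by linarith)
  log_pos := by
    rw [dpParams_log hM hT]
    have := log_two_mul_pos hM
    have := log_mul_nonneg hM hT
    linarith

/-- The failure probability of a single confidence interval. -/
lemma exp_width_dpParams (hk : 2 ≤ k) (hM : 1 ≤ M) (hT : 1 ≤ T) (hν : 0 < ν₁) (hρ₀ : 0 < ρ)
    (hρ₁ : ρ < 1) (h : ℕ) :
    2 * Real.exp (-((M * (dpParams k M T ν₁ ρ ε).pulls h : ℕ) *
      (dpParams k M T ν₁ ρ ε).width h ^ 2) / (2 * (1 / 4 + noiseVar ε (1 / (M : ℝ))))) =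
      (M : ℝ)⁻¹ * (((M : ℝ) * T) ^ 8)⁻¹ := by
  have hA := dpParams_admissible (ε := ε) hk hM hT hν hρ₀ hρ₁
  have hv := noiseVar_nonneg (ε := ε) hM
  have hM' : (0 : ℝ) < M := by exact_mod_cast hM
  have hT' : (0 : ℝ) < T := by exact_mod_cast hT
  have hpos : (0 : ℝ) < (M * (dpParams k M T ν₁ ρ ε).pulls h : ℕ) := by
    exact_mod_cast Nat.mul_pos hM (hA.pulls_pos h)
  have hw : (M * (dpParams k M T ν₁ ρ ε).pulls h : ℕ) * (dpParams k M T ν₁ ρ ε).width h ^ 2 =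
      (4 + 16 * noiseVar ε (1 / (M : ℝ))) * (1 / 8 * Real.log (2 * M) + Real.log (M * T)) := by
    have hL := hA.log_pos
    rw [Params.width, mul_pow, Real.sq_sqrt (div_nonneg hL.le (Nat.cast_nonneg _)),
      dpParams_c_sq hM, dpParams_log hM hT]
    change ((M * (dpParams k M T ν₁ ρ ε).pulls h : ℕ) : ℝ) * (_ *
      (_ / ((M * (dpParams k M T ν₁ ρ ε).pulls h : ℕ) : ℝ))) = _
    field_simp
  -- Since `c² = 16 (1/4 + σ²)`, the exponent is `-8` times the logarithm; the power `1/8` in `c₁`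
  -- turns this into a factor `1 / (2 M)`, whose 2 cancels that of the two-sided tail.
  have hexp : -((4 + 16 * noiseVar ε (1 / (M : ℝ))) *
      (1 / 8 * Real.log (2 * M) + Real.log (M * T))) / (2 * (1 / 4 + noiseVar ε (1 / (M : ℝ)))) =
      -Real.log (2 * M) + -((8 : ℕ) * Real.log (M * T)) := by
    have : (2 * (1 / 4 + noiseVar ε (1 / (M : ℝ)))) ≠ 0 := by positivity
    rw [div_eq_iff this]
    push_cast
    ring
  rw [hw, hexp, Real.exp_add, Real.exp_neg, Real.exp_neg, ← Real.log_pow,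
    Real.exp_log (by positivity), Real.exp_log (by positivity)]
  field_simp

/-- The `+ 1` on the left is the contribution of the bad event. The logarithm in `scale 0` is at
least 1 and can be dropped; replacing `ρ²` by `ρ² - ρ³` only enlarges the bound. -/
lemma C₃_term_bound (hk : 2 ≤ k) (hM : 1 ≤ M) (hT : 1 ≤ T) (hν : 0 < ν₁) (hρ₀ : 0 < ρ)
    (hρ₁ : ρ < 1) (hε : 0 < ε) (hMT : 1 ≤ Real.log ((M : ℝ) * T)) :
    48 * k * ν₁ / ρ ^ 2 * M *
        (M / (dpParams k M T ν₁ ρ ε).scale 0) ^ (-(1 / (2 * Real.logb k ρ))) + 1 ≤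
      C₃ k ν₁ ρ ε (1 / (M : ℝ)) * (M : ℝ) ^ (1 - 1 / (2 * Real.logb k ρ)) := by
  have hM' : (1 : ℝ) ≤ M := by exact_mod_cast hM
  have hlog := log_confidence_pos hM
  have hk' : (1 : ℝ) < k := by exact_mod_cast hk
  have hlogb : Real.logb k ρ < 0 := Real.logb_neg hk' hρ₀ hρ₁
  set a := -(1 / (2 * Real.logb k ρ)) with ha
  have ha0 : 0 ≤ a := by
    rw [ha, ← one_div_neg_eq_neg_one_div]
    exact one_div_nonneg.2 (by linarith)
  have hpow : (M : ℝ) ^ (1 - 1 / (2 * Real.logb k ρ)) = M * (M : ℝ) ^ a := by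
    rw [sub_eq_add_neg, ← ha, Real.rpow_add (by positivity), Real.rpow_one]
  have hscale : (M : ℝ) / (dpParams k M T ν₁ ρ ε).scale 0 ≤
      ν₁ ^ 2 * ε ^ 2 / (4 * ε ^ 2 + 32 * Real.log (1.25 / (1 / (M : ℝ)))) * M := by
    have h1 : (dpParams k M T ν₁ ρ ε).scale 0 =
        (4 * ε ^ 2 + 32 * Real.log (1.25 / (1 / (M : ℝ)))) / (ν₁ ^ 2 * ε ^ 2) *
          (1 / 8 * Real.log (2 * M) + Real.log (M * T)) := by
      rw [Params.scale, dpParams_c_sq_eq_div hM hε, dpParams_log hM hT]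
      simp only [dpParams, mul_zero, pow_zero, inv_one, mul_one]
      field_simp
    have h2 : 1 ≤ 1 / 8 * Real.log (2 * M) + Real.log (M * T) := by
      have := log_two_mul_pos hM
      linarith
    rw [h1]
    calc _ ≤ (M : ℝ) / ((4 * ε ^ 2 + 32 * Real.log (1.25 / (1 / (M : ℝ)))) / (ν₁ ^ 2 * ε ^ 2) * 1) := by
          gcongr
      _ = _ := by
          rw [mul_one]
          field_simp
  have hA := dpParams_admissible (ε := ε) hk hM hT hν hρ₀ hρ₁
  have hρ3 : 0 < ρ ^ 2 - ρ ^ 3 := by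
    have : ρ ^ 2 - ρ ^ 3 = ρ ^ 2 * (1 - ρ) := by ring
    rw [this]
    exact mul_pos (by positivity) (by linarith)
  have hfirst : 48 * k * ν₁ / ρ ^ 2 * M * (M / (dpParams k M T ν₁ ρ ε).scale 0) ^ a ≤
      48 * k * ν₁ / (ρ ^ 2 - ρ ^ 3) * M *
        (ν₁ ^ 2 * ε ^ 2 / (4 * ε ^ 2 + 32 * Real.log (1.25 / (1 / (M : ℝ)))) * M) ^ a := by
    have h0 := hA.scale_pos 0
    have h3 : ρ ^ 2 - ρ ^ 3 ≤ ρ ^ 2 := by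
      have : 0 < ρ ^ 3 := by positivity
      linarith
    gcongr
  rw [Real.mul_rpow (by positivity) (by positivity)] at hfirst
  have hsecond : 1 ≤ M * (M : ℝ) ^ a :=
    one_le_mul_of_one_le_of_one_le hM' (Real.one_le_rpow hM' ha0)
  rw [hpow, C₃, ← ha, add_mul, one_mul]
  linarith

lemma one_le_C₃_term (hk : 2 ≤ k) (hM : 1 ≤ M) (hν : 0 < ν₁) (hρ₀ : 0 < ρ)
    (hρ₁ : ρ < 1) :
    1 ≤ C₃ k ν₁ ρ ε (1 / (M : ℝ)) * (M : ℝ) ^ (1 - 1 / (2 * Real.logb k ρ)) := by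
  have hM' : (1 : ℝ) ≤ M := by exact_mod_cast hM
  have hlog := log_confidence_pos hM
  have hk' : (1 : ℝ) < k := by exact_mod_cast hk
  have hlogb : Real.logb k ρ < 0 := Real.logb_neg hk' hρ₀ hρ₁
  have hρ3 : 0 < ρ ^ 2 - ρ ^ 3 := by
    have : ρ ^ 2 - ρ ^ 3 = ρ ^ 2 * (1 - ρ) := by ring
    rw [this]
    exact mul_pos (by positivity) (by linarith)
  refine one_le_mul_of_one_le_of_one_le ?_ (Real.one_le_rpow hM' ?_)
  · unfold C₃
    have : 0 ≤ 48 * k * ν₁ / (ρ ^ 2 - ρ ^ 3) *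
        (ν₁ ^ 2 * ε ^ 2 / (4 * ε ^ 2 + 32 * Real.log (1.25 / (1 / (M : ℝ))))) ^
          (-(1 / (2 * Real.logb k ρ))) := by positivity
    linarith
  · have : 1 / (2 * Real.logb k ρ) ≤ 0 := one_div_nonpos.2 (by linarith)
    linarith

lemma one_lt_rpow_neg (hρ₀ : 0 < ρ) (hρ₁ : ρ < 1) (hd : 0 ≤ d) : 1 < ρ ^ (-(d + 1)) :=
  Real.one_lt_rpow_of_pos_of_lt_one_of_neg hρ₀ hρ₁ (by linarith)

lemma C₄_term_eq (hk : 2 ≤ k) (hM : 1 ≤ M) (hT : 1 ≤ T) (hν : 0 < ν₁) (hρ₀ : 0 < ρ)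
    (hρ₁ : ρ < 1) (hε : 0 < ε) (hC : 0 < C) (hd : 0 ≤ d) :
    C₄ k M ν₁ ρ C d ε (1 / (M : ℝ)) * ((M : ℝ) ^ ((d + 1) / (d + 2)) * (T : ℝ) ^ ((d + 1) / (d + 2)) *
          Real.log (M * T) ^ (1 / (d + 2))) =
      2 * (24 * k * C * (dpParams k M T ν₁ ρ ε).c ^ 2 * ρ ^ (-(d + 4)) * (12 * ν₁) ^ (d + 1) /
        (ν₁ * (ρ ^ (-(d + 1)) - 1)) * (((M : ℝ) * T) ^ (d + 1) *
          Real.log (M * T))) ^ (1 / (d + 2)) * (1 + 1 / 8 * Real.log (2 * M)) := by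
  have hM' : (0 : ℝ) < M := by exact_mod_cast hM
  have hT' : (0 : ℝ) < T := by exact_mod_cast hT
  have hk' : (0 : ℝ) < k := by exact_mod_cast (by omega : 0 < k)
  have hlog := log_confidence_pos hM
  have hlogMT := log_mul_nonneg hM hT
  have hb : 0 < ρ ^ (-(d + 1)) - 1 := by
    have := one_lt_rpow_neg hρ₀ hρ₁ hd
    linarith
  rw [dpParams_c_sq_eq_div hM hε]
  have heq : 24 * k * C * ((4 * ε ^ 2 + 32 * Real.log (1.25 / (1 / (M : ℝ)))) / ε ^ 2) *
      ρ ^ (-(d + 4)) * (12 * ν₁) ^ (d + 1) / (ν₁ * (ρ ^ (-(d + 1)) - 1)) =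
      24 * k * C * (4 * ε ^ 2 + 32 * Real.log (1.25 / (1 / (M : ℝ)))) * ρ ^ (-(d + 4)) *
        (12 * ν₁) ^ (d + 1) / (ν₁ * ε ^ 2 * (ρ ^ (-(d + 1)) - 1)) := by
    rw [mul_div_assoc', div_mul_eq_mul_div, div_mul_eq_mul_div, div_div]
    congr 1
    ring
  rw [heq, Real.mul_rpow (by positivity) (by positivity),
    Real.mul_rpow (by positivity) hlogMT, ← Real.rpow_mul (by positivity), mul_one_div,
    Real.mul_rpow hM'.le hT'.le, C₄]
  ring

/-- With `log (M T) ≥ 1`, the logarithm with `c₁` is at most `w log (M T)`, and `w ^ (1 / (d + 2)) ≤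
w` because `w ≥ 1`. -/
lemma C₄_term_bound (hk : 2 ≤ k) (hM : 1 ≤ M) (hT : 1 ≤ T) (hν : 0 < ν₁) (hρ₀ : 0 < ρ)
    (hρ₁ : ρ < 1) (hε : 0 < ε) (hC : 0 < C) (hd : 0 ≤ d) (hMT : 1 ≤ Real.log ((M : ℝ) * T)) :
    2 * (24 * k * C * (dpParams k M T ν₁ ρ ε).c ^ 2 * ρ ^ (-(d + 4)) * (12 * ν₁) ^ (d + 1) /
        (ν₁ * (ρ ^ (-(d + 1)) - 1)) * (((M : ℝ) * T) ^ (d + 1) *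
          (1 / 8 * Real.log (2 * M) + Real.log (M * T)))) ^ (1 / (d + 2)) ≤
      C₄ k M ν₁ ρ C d ε (1 / (M : ℝ)) * ((M : ℝ) ^ ((d + 1) / (d + 2)) * (T : ℝ) ^ ((d + 1) / (d + 2)) *
          Real.log (M * T) ^ (1 / (d + 2))) := by
  have hM' : (0 : ℝ) < M := by exact_mod_cast hM
  have hT' : (0 : ℝ) < T := by exact_mod_cast hT
  have hlog2 := log_two_mul_pos hM
  have hb : 0 < ρ ^ (-(d + 1)) - 1 := by
    have := one_lt_rpow_neg hρ₀ hρ₁ hd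
    linarith
  rw [C₄_term_eq hk hM hT hν hρ₀ hρ₁ hε hC hd]
  set Q := 24 * k * C * (dpParams k M T ν₁ ρ ε).c ^ 2 * ρ ^ (-(d + 4)) * (12 * ν₁) ^ (d + 1) /
        (ν₁ * (ρ ^ (-(d + 1)) - 1)) with hQ
  have hQ0 : 0 ≤ Q := by positivity
  set w := 1 + 1 / 8 * Real.log (2 * M) with hw
  have hw1 : 1 ≤ w := by linarith
  have h1 : Q * (((M : ℝ) * T) ^ (d + 1) * (1 / 8 * Real.log (2 * M) + Real.log (M * T))) ≤
      Q * (((M : ℝ) * T) ^ (d + 1) * Real.log (M * T)) * w := by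
    rw [mul_assoc, mul_assoc ((M * T : ℝ) ^ (d + 1))]
    gcongr
    rw [hw]
    nlinarith
  have hL0 : 0 ≤ 1 / 8 * Real.log (2 * M) + Real.log (M * T) := by linarith
  calc _ ≤ 2 * (Q * (((M : ℝ) * T) ^ (d + 1) * Real.log (M * T)) * w) ^ (1 / (d + 2)) := by
        gcongr
    _ = 2 * (Q * (((M : ℝ) * T) ^ (d + 1) * Real.log (M * T))) ^ (1 / (d + 2)) *
          w ^ (1 / (d + 2)) := by
        rw [Real.mul_rpow (by positivity) (by positivity), mul_assoc]
    _ ≤ _ := by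
        gcongr
        refine (Real.rpow_le_rpow_of_exponent_le hw1 ?_).trans_eq (Real.rpow_one w)
        rw [div_le_one (by linarith)]
        linarith

/-- For two pulls in all, the second term of the bound exceeds the trivial bound of the regret. -/
lemma two_mul_le_C₄_term (hk : 2 ≤ k) (hM : 1 ≤ M) (hT : 1 ≤ T) (hν : 0 < ν₁) (hρ₀ : 0 < ρ)
    (hρ₁ : ρ < 1) (hε : 0 < ε) (hC : 1 ≤ C) (hd : 0 ≤ d) (hMT : M * T = 2) :
    2 * min 1 ν₁ ≤
      C₄ k M ν₁ ρ C d ε (1 / (M : ℝ)) * ((M : ℝ) ^ ((d + 1) / (d + 2)) * (T : ℝ) ^ ((d + 1) / (d + 2)) *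
          Real.log (M * T) ^ (1 / (d + 2))) := by
  have hMT' : (M : ℝ) * T = 2 := by exact_mod_cast hMT
  have hlog2 := log_two_mul_pos hM
  have hk' : (2 : ℝ) ≤ k := by exact_mod_cast hk
  have hb := one_lt_rpow_neg hρ₀ hρ₁ hd
  have hb' : 0 < ρ ^ (-(d + 1)) - 1 := by linarith
  have hv := noiseVar_nonneg (ε := ε) hM
  have hu : 0 < min 1 ν₁ := lt_min one_pos hν
  rw [C₄_term_eq hk hM hT hν hρ₀ hρ₁ hε (by linarith) hd, hMT', dpParams_c_sq hM]
  set Q := 24 * k * C * (4 + 16 * noiseVar ε (1 / (M : ℝ))) * ρ ^ (-(d + 4)) *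
    (12 * ν₁) ^ (d + 1) / (ν₁ * (ρ ^ (-(d + 1)) - 1)) with hQ
  have hρpow : 1 ≤ ρ ^ (-(d + 4)) / (ρ ^ (-(d + 1)) - 1) := by
    rw [one_le_div hb']
    have : ρ ^ (-(d + 1)) ≤ ρ ^ (-(d + 4)) :=
      Real.rpow_le_rpow_of_exponent_ge hρ₀ hρ₁.le (by linarith)
    linarith
  have hQ1 : 2 * ν₁ ^ d ≤ Q := by
    have h1 : Q = (24 * k * C * (4 + 16 * noiseVar ε (1 / (M : ℝ))) * (12 : ℝ) ^ (d + 1)) *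
        (ρ ^ (-(d + 4)) / (ρ ^ (-(d + 1)) - 1)) * ν₁ ^ d := by
      rw [hQ, Real.mul_rpow (by norm_num) hν.le, Real.rpow_add_one hν.ne']
      field_simp
    have h2 : 1 ≤ (12 : ℝ) ^ (d + 1) := Real.one_le_rpow (by norm_num) (by linarith)
    have h3 : (2 : ℝ) ≤ 24 * k * C * (4 + 16 * noiseVar ε (1 / (M : ℝ))) * (12 : ℝ) ^ (d + 1) := by
      calc (2 : ℝ) ≤ 24 * 2 * 1 * 4 * 1 := by norm_num
        _ ≤ _ := by
          gcongr
          linarith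
    have h4 : 0 < ν₁ ^ d := by positivity
    rw [h1]
    gcongr
    nlinarith
  -- Lowering the exponent uses `min 1 ν₁ ≤ 1`, changing the base uses `min 1 ν₁ ≤ ν₁`; so small and
  -- large `ν₁` are covered at once.
  have hQ2 : (min 1 ν₁) ^ (d + 2) ≤ Q * ((2 : ℝ) ^ (d + 1) * Real.log 2) := by
    have h1 : (min 1 ν₁) ^ (d + 2) ≤ (min 1 ν₁) ^ d :=
      Real.rpow_le_rpow_of_exponent_ge hu (min_le_left _ _) (by linarith)
    have h2 : (min 1 ν₁) ^ d ≤ ν₁ ^ d := Real.rpow_le_rpow hu.le (min_le_right _ _) hd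
    have h3 : 1 ≤ (2 : ℝ) ^ (d + 1) := Real.one_le_rpow (by norm_num) (by linarith)
    have h4 : 1 / 2 ≤ (2 : ℝ) ^ (d + 1) * Real.log 2 := by
      have := Real.log_two_gt_d9
      nlinarith
    have h5 : 0 < ν₁ ^ d := by positivity
    calc _ ≤ 2 * ν₁ ^ d * (1 / 2) := by linarith
      _ ≤ _ := by gcongr
  have hroot : min 1 ν₁ ≤ (Q * ((2 : ℝ) ^ (d + 1) * Real.log 2)) ^ (1 / (d + 2)) := by
    have hd2 : d + 2 ≠ 0 := by linarith
    calc min 1 ν₁ = ((min 1 ν₁) ^ (d + 2)) ^ (1 / (d + 2)) := by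
          rw [← Real.rpow_mul hu.le, mul_one_div_cancel hd2, Real.rpow_one]
      _ ≤ _ := by gcongr
  nlinarith

end Constants

end FedBandit

/-! ### Expectation over the good and the bad event. -/

theorem mainTheorem4 {X Ω : Type*} [MeasurableSpace Ω] (μ : Measure Ω) [IsProbabilityMeasure μ]
    (k M T : ℕ) (hk : 2 ≤ k) (hM : 1 ≤ M) (hT : 1 ≤ T)
    (P : FedBandit.HierarchicalPartition X k)
    (floc : Fin M → X → ℝ) (hfloc : ∀ m x, floc m x ∈ Set.Icc (0 : ℝ) 1)
    (l : X → X → ℝ) (ν₁ ρ : ℝ) (hν₁ : 0 < ν₁) (hρ₀ : 0 < ρ) (hρ₁ : ρ < 1)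
    (hsmooth : FedBandit.LocallySmooth P (FedBandit.globalObj floc) l ν₁ ρ)
    (C d : ℝ) (hd : 0 ≤ d)
    (hdim : FedBandit.NearOptimalityDim P (FedBandit.globalObj floc) ν₁ ρ C d)
    (ε : ℝ) (hε : 0 < ε)
    (r z : Fin M → ℕ → ℕ → ℕ → Ω → ℝ)
    (henv : FedBandit.Environment P floc (FedBandit.noiseVar ε (1 / (M : ℝ))) μ r z)
    (order : Fin M → ℕ → Finset ℕ → List ℕ)
    (horder : ∀ m h K, (order m h K).Perm K.toList) :
    Integrable (fun ω => (FedBandit.dpParams k M T ν₁ ρ ε).regret P (FedBandit.globalObj floc) order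
      (fun m h i s => r m h i s ω + z m h i s ω)) μ ∧
    ∫ ω, (FedBandit.dpParams k M T ν₁ ρ ε).regret P (FedBandit.globalObj floc) order
      (fun m h i s => r m h i s ω + z m h i s ω) ∂μ ≤
      FedBandit.C₃ k ν₁ ρ ε (1 / (M : ℝ)) * (M : ℝ) ^ (1 - 1 / (2 * Real.logb k ρ)) +
      FedBandit.C₄ k M ν₁ ρ C d ε (1 / (M : ℝ)) *
        ((M : ℝ) ^ ((d + 1) / (d + 2)) * (T : ℝ) ^ ((d + 1) / (d + 2)) *
          Real.log (M * T) ^ (1 / (d + 2))) := by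
  set A := FedBandit.dpParams k M T ν₁ ρ ε with hA_def
  set f := FedBandit.globalObj floc with hf_def
  set y : Ω → Fin M → ℕ → ℕ → ℕ → ℝ := fun ω m h i s => r m h i s ω + z m h i s ω with hy_def
  have hA : A.Admissible := FedBandit.dpParams_admissible hk hM hT hν₁ hρ₀ hρ₁
  have hf : BddAbove (Set.range f) := by
    refine ⟨1, ?_⟩
    rintro _ ⟨x, rfl⟩
    exact (FedBandit.globalObj_mem_Icc hfloc x).2
  have hgap_one : ∀ x, (⨆ z, f z) - f x ≤ 1 := by
    intro x
    have : Nonempty X := ⟨x⟩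
    have h1 : (⨆ z, f z) ≤ 1 := ciSup_le fun z => (FedBandit.globalObj_mem_Icc hfloc z).2
    have h2 : 0 ≤ f x := (FedBandit.globalObj_mem_Icc hfloc x).1
    linarith
  have hgap_ν : ∀ x, (⨆ z, f z) - f x ≤ ν₁ := hsmooth.gap_le hν₁ hρ₀
  have hC : 1 ≤ C := hdim.one_le hsmooth hν₁ hρ₀
  have hymeas : ∀ h i, FedBandit.IsNode A.k h i → ∀ m s, Measurable fun ω => y ω m h i s :=
    fun h i hi m s => (henv.reward_measurable m h i s hi).add (henv.noise_measurable m h i s hi)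
  have hmeas : Measurable fun ω => A.regret P f order (y ω) :=
    FedBandit.Params.measurable_regret (A := A) hymeas P f order
  have hnonneg : ∀ ω, 0 ≤ A.regret P f order (y ω) := fun ω => FedBandit.Params.regret_nonneg hf
  have hle_one : ∀ ω, A.regret P f order (y ω) ≤ M * T * 1 := fun ω =>
    FedBandit.Params.regret_le_of_gap_le (A := A) hgap_one
  have hle_ν : ∀ ω, A.regret P f order (y ω) ≤ M * T * ν₁ := fun ω =>
    FedBandit.Params.regret_le_of_gap_le (A := A) hgap_ν
  have hint : Integrable (fun ω => A.regret P f order (y ω)) μ :=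
    Integrable.of_mem_Icc 0 (M * T * 1) hmeas.aemeasurable
      (Filter.Eventually.of_forall fun ω => ⟨hnonneg ω, hle_one ω⟩)
  refine ⟨hint, ?_⟩
  change ∫ ω, A.regret P f order (y ω) ∂μ ≤ _
  have hM' : (0 : ℝ) < M := by exact_mod_cast hM
  have hT' : (0 : ℝ) < T := by exact_mod_cast hT
  have hconst : ∀ b : ℝ, (∀ ω, A.regret P f order (y ω) ≤ b) →
      ∫ ω, A.regret P f order (y ω) ∂μ ≤ b := fun b hb => by
    simpa using integral_mono hint (integrable_const b) hb
  have hb : 0 < ρ ^ (-(d + 1)) - 1 := by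
    have := FedBandit.one_lt_rpow_neg hρ₀ hρ₁ hd
    linarith
  have hC3 := FedBandit.one_le_C₃_term (ε := ε) hk hM hν₁ hρ₀ hρ₁
  by_cases hMT3 : 3 ≤ M * T
  · have hlogMT : 1 ≤ Real.log ((M : ℝ) * T) := by
      have h3 : (3 : ℝ) ≤ M * T := by exact_mod_cast hMT3
      rw [Real.le_log_iff_exp_le (by positivity)]
      exact Real.exp_one_lt_three.le.trans h3
    have hC3b := FedBandit.C₃_term_bound hk hM hT hν₁ hρ₀ hρ₁ hε hlogMT
    have hC4b := FedBandit.C₄_term_bound (C := C) hk hM hT hν₁ hρ₀ hρ₁ hε (by linarith) hd hlogMT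
    rw [← hA_def] at hC3b hC4b
    set B := {ω | ¬ A.WellEstimated (y ω) fun h i => f (P.point h i)} with hB
    have hgood : ∀ ω, ω ∉ B → A.regret P f order (y ω) ≤ _ := fun ω hω =>
      hA.regret_le hT hf hsmooth (not_not.1 hω) (by linarith) hd hdim horder
    rw [FedBandit.dpParams_log hM hT] at hgood
    have hq := hA.measure_not_wellEstimated_le (P := P) henv (q := ENNReal.ofReal
      ((M : ℝ)⁻¹ * (((M : ℝ) * T) ^ 8)⁻¹)) fun h i hi => by
        have h1 := henv.measure_deviation_le (FedBandit.noiseVar_nonneg hM) hi (hA.pulls_pos h) hM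
          (hA.width_nonneg h)
        rwa [FedBandit.exp_width_dpParams hk hM hT hν₁ hρ₀ hρ₁ h] at h1
    -- The measurable hull has the same measure as `B` and spares a proof that `B` is measurable.
    -- The trivial regret `M T` on it costs at most `(M T)⁻⁶ ≤ 1`.
    have hbad : M * T * μ.real (toMeasurable μ B) ≤ 1 := by
      have h1 : μ.real (toMeasurable μ B) ≤ T * ((M : ℝ)⁻¹ * (((M : ℝ) * T) ^ 8)⁻¹) := by
        rw [Measure.real, measure_toMeasurable]
        refine ENNReal.toReal_le_of_le_ofReal (by positivity) ?_
        rw [ENNReal.ofReal_mul hT'.le, ENNReal.ofReal_natCast]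
        exact hq
      have h2 : 1 ≤ (M : ℝ) * T := by exact_mod_cast (by omega : 1 ≤ M * T)
      have h3 : (T : ℝ) ≤ M * T := le_mul_of_one_le_left hT'.le (by exact_mod_cast hM)
      calc (M : ℝ) * T * μ.real (toMeasurable μ B) ≤
            M * T * (T * ((M : ℝ)⁻¹ * (((M : ℝ) * T) ^ 8)⁻¹)) := by gcongr
        _ = T * T * (((M : ℝ) * T) ^ 8)⁻¹ := by field_simp
        _ ≤ (M * T) * (M * T) * (((M : ℝ) * T) ^ 8)⁻¹ := by gcongr
        _ = (((M : ℝ) * T) ^ 6)⁻¹ := by field_simp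
        _ ≤ 1 := inv_le_one_of_one_le₀ (one_le_pow₀ h2)
    set R := 48 * k * ν₁ / ρ ^ 2 * M *
        (M / A.scale 0) ^ (-(1 / (2 * Real.logb k ρ))) +
      2 * (24 * k * C * A.c ^ 2 * ρ ^ (-(d + 4)) * (12 * ν₁) ^ (d + 1) /
        (ν₁ * (ρ ^ (-(d + 1)) - 1)) * (((M : ℝ) * T) ^ (d + 1) *
          (1 / 8 * Real.log (2 * M) + Real.log (M * T)))) ^ (1 / (d + 2)) with hR
    have hR0 : 0 ≤ R := by
      have h0 := hA.scale_pos 0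
      have h2 := FedBandit.log_two_mul_pos hM
      have h3 : 0 ≤ 1 / 8 * Real.log (2 * M) + Real.log ((M : ℝ) * T) := by linarith
      positivity
    have hmono : ∫ ω, A.regret P f order (y ω) ∂μ ≤
        ∫ ω, (R + (toMeasurable μ B).indicator (fun _ => (M : ℝ) * T) ω) ∂μ := by
      refine integral_mono hint ((integrable_const R).add
        ((integrable_const _).indicator (measurableSet_toMeasurable μ B))) fun ω => ?_
      by_cases hω : ω ∈ toMeasurable μ B
      · simp only [Set.indicator_of_mem hω]
        have := hle_one ω
        linarith
      · simp only [Set.indicator_of_notMem hω, add_zero]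
        exact hgood ω fun h => hω (subset_toMeasurable μ B h)
    rw [integral_add (integrable_const R)
      ((integrable_const _).indicator (measurableSet_toMeasurable μ B)),
      integral_indicator_const _ (measurableSet_toMeasurable μ B)] at hmono
    simp only [integral_const, probReal_univ, smul_eq_mul] at hmono
    linarith
  · have hpos : 0 < M * T := Nat.mul_pos hM hT
    have hlog := FedBandit.log_mul_nonneg hM hT
    -- For `M T = 1` the logarithm is zero and the `+ 1` in `C₃` pays for the only pull; for `M T =
    -- 2` the second term covers `2 min 1 ν₁`.
    obtain hMT | hMT : M * T = 1 ∨ M * T = 2 := by omega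
    · have hMT' : (M : ℝ) * T = 1 := by exact_mod_cast hMT
      have h1 := hconst _ hle_one
      have h2 : 0 ≤ FedBandit.C₄ k M ν₁ ρ C d ε (1 / (M : ℝ)) *
          ((M : ℝ) ^ ((d + 1) / (d + 2)) * (T : ℝ) ^ ((d + 1) / (d + 2)) *
            Real.log (M * T) ^ (1 / (d + 2))) := by
        have h3 := FedBandit.log_two_mul_pos hM
        rw [FedBandit.C₄_term_eq hk hM hT hν₁ hρ₀ hρ₁ hε (by linarith) hd]
        positivity
      rw [hMT'] at h1
      linarith
    · have hMT' : (M : ℝ) * T = 2 := by exact_mod_cast hMT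
      have h1 := hconst _ hle_one
      have h2 := hconst _ hle_ν
      have h3 := FedBandit.two_mul_le_C₄_term hk hM hT hν₁ hρ₀ hρ₁ hε hC hd hMT
      rw [hMT'] at h1 h2
      have h4 : ∫ ω, A.regret P f order (y ω) ∂μ ≤ 2 * min 1 ν₁ := by
        rcases min_choice 1 ν₁ with h | h <;> rw [h] <;> assumption
      linarith
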